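/- Let $J=[-1,1]$, let $D^2\subset\mathbb{R}^2$ be the closed unit disc, and let $\iota:D^2\amalg D^2\to D^2$ be the embedding that rescales the two discs to radius $1/8$ and translates them to be centered at $(0,1/2)$ (upper) and $(0,-1/2)$ (lower). **Spaces.** A *framed long knot* is a smooth embedding $\mathbb{R}\times D^2\to\mathbb{R}\times D^2$ that is the identity outside of $J\times D^2$; their space is $EC(1,D^2)$. A *framed string $2$-link* is a smooth embedding $(\mathbb{R}\times D^2)\amalg(\mathbb{R}\times D^2)\to\mathbb{R}\times D^2$ that agrees with $\mathrm{id}_{\mathbb R}\times\iota$ outside of $(J\times D^2)^{\amalg 2}$ and maps the interior of $(J\times D^2)^{\amalg 2}$ into the interior of $J\times D^2$ (interiors relative to $\mathbb{R}\times D^2$); their space is $EC_\iota(1,D^2)$. The linking number $lk$ of two disjoint smooth long curves in $\mathbb{R}^3$, each agreeing near infinity with one of two distinct parallel lines, is that of the closed curves obtained by closing them up far away by disjoint arcs in the plane of these lines; it is given by Gauss' linking integral. The framing number of a framed long knot $f$ is $\omega(f)=lk(f|_{\mathbb{R}\times(0,0)},f|_{\mathbb{R}\times(0,1)})$, and that of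 a framed string $2$-link $f$ is $\omega(f)=(\omega_\uparrow(f),\omega_\downarrow(f))$, with the same formula applied to its upper strand $f^\uparrow$ and its lower strand $f^\downarrow$. Set $$\widehat{\mathcal K}=\{f\in EC(1,D^2):\ \omega(f)=0\},\qquad \widehat{\mathcal L}^0=\{f\in EC_\iota(1,D^2):\ \omega(f)=(0,0),\ lk(f^\uparrow|_{\mathbb{R}\times(0,0)},f^\downarrow|_{\mathbb{R}\times(0,0)})=0\}.$$ **The operad $\mathcal{SCL}$.** The colors are $o,\uparrow,\downarrow,\updownarrow$. A little square is a map $L=l^1\times l^2:J^2\to J^2$ with $l^1,l^2$ affine increasing; two of them are almost disjoint if the interiors of their images are disjoint, and $L$ meets the lower face if $l^2(-1)=-1$. Let $\underline t=(t_1,\dots,t_n)$ be input colors, $n\ge 0$. For $s\neq o$, $\mathcal{SCL}(\underline t;s)$ is empty unless all $t_i=s$, in which case it consists of the $n$-tuples of pairwise almost disjoint little squares. $\mathcal{SCL}(\underline t;o)$ consists of the $n$-tuples $(L^1,\dots,L^n)$ of little squares such that those with $t_i=o$ meet the lower face and are almost disjoint from every other one, and any two with the same color are almost disjoint. **The action on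 $X$.** Let $X_o=EC_\iota(1,D^2)$ and $X_\uparrow=X_\downarrow=X_\updownarrow=EC(1,D^2)$. Write $L_\pi=l^1$. An affine increasing $l$ acts by $lf=(l\times\mathrm{id})\circ f\circ(l^{-1}\times\mathrm{id})$ on $EC(1,D^2)$, and likewise (with $(l^{-1}\times \mathrm{id})^{\amalg2}$ on the right) on $EC_\iota(1,D^2)$. On little squares consider the partial order generated by: $L^i<L^j$ if $l^{i,2}(-1)<l^{j,2}(-1)$ and the interiors of the images of $L^i_\pi$ and $L^j_\pi$ meet. For pairwise almost disjoint little squares, $\kappa(L,\boldsymbol f)=(L^{\sigma(1)}_\pi f_{\sigma(1)})\circ\cdots\circ(L^{\sigma(k)}_\pi f_{\sigma(k)})$, where $\sigma$ lists the squares in non-decreasing order (no square precedes one that was listed earlier); $\kappa^{rev}$ uses non-increasing order instead. (Neither depends on the choice of $\sigma$.) For almost disjoint intervals $l^i$, $\lambda(l,\boldsymbol f)$ is the framed string $2$-link equal to $l^if_i$ over $l^i(J)$ and to $\mathrm{id}_{\mathbb R}\times\iota$ elsewhere. For $L\in\mathcal{SCL}(\underline t;s)$ and $\boldsymbol f\in\prod_iX_{t_i}$,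 with $L_c,\boldsymbol f_c$ denoting the entries of color $c$, put $\mu(L)(\boldsymbol f)=\kappa(L,\boldsymbol f)$ if $s\in\{\uparrow,\downarrow\}$, $\mu(L)(\boldsymbol f)=\kappa^{rev}(L,\boldsymbol f)$ if $s=\updownarrow$, and for $s=o$ $$\mu(L)(\boldsymbol f)=\kappa^{rev}(L_\updownarrow,\boldsymbol f_\updownarrow)\circ\lambda((L_o)_\pi,\boldsymbol f_o)\circ\big[\kappa(L_\uparrow,\boldsymbol f_\uparrow)\amalg\kappa(L_\downarrow,\boldsymbol f_\downarrow)\big].$$ **Theorem.** The quadruplet $A=(A_o,A_\uparrow,A_\downarrow,A_\updownarrow)=(\widehat{\mathcal L}^0,\widehat{\mathcal K},\widehat{\mathcal K},\widehat{\mathcal K})$ is a sub-$\mathcal{SCL}$-algebra of $X$, i.e. it is closed under all operations: for all $n\ge0$, $\underline t$, $s$, $L\in\mathcal{SCL}(\underline t;s)$ and $\boldsymbol f\in\prod_iA_{t_i}$, one has $\mu(L)(\boldsymbol f)\in A_s$. -/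

import Mathlib

namespace StringLinks

open Set Topology
open scoped ContDiff

/-! ## The solid tube and smooth maps -/

/-- The solid tube `ℝ × D²`, where `D²` is the closed unit disc of `ℂ = ℝ²`; the point `(x, y)` of
the disc is `x + y i`. -/
abbrev Tube : Type := ℝ × Metric.closedBall (0 : ℂ) 1

/-- The inclusion of the tube in `ℝ³ = ℝ × ℂ`. -/
def incl (p : Tube) : ℝ × ℂ := (p.1, (p.2 : ℂ))

/-- `f : ℝ × D² → ℝ × D²` is a smooth immersion: it extends to a `C^∞` map `ℝ³ → ℝ³`, whose
differential is injective at every point of the tube. (The differential at a point of the tube does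
not depend on the extension, the tube being a closed convex set with non-empty interior.) -/
def IsSmoothImmersion (f : Tube → Tube) : Prop :=
  ∃ F : ℝ × ℂ → ℝ × ℂ, ContDiff ℝ ∞ F ∧ (∀ p, F (incl p) = incl (f p)) ∧
    ∀ p, Function.Injective (fderiv ℝ F (incl p))

theorem isEmbedding_incl : IsEmbedding incl :=
  IsEmbedding.id.prodMap IsEmbedding.subtypeVal

theorem incl_injective : Function.Injective incl := isEmbedding_incl.injective

theorem IsSmoothImmersion.continuous {f : Tube → Tube} (hf : IsSmoothImmersion f) :
    Continuous f := by
  obtain ⟨F, hF, hFf, -⟩ := hf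
  rw [isEmbedding_incl.continuous_iff]
  have : incl ∘ f = F ∘ incl := funext fun p => (hFf p).symm
  rw [this]
  exact hF.continuous.comp isEmbedding_incl.continuous

theorem IsSmoothImmersion.comp {f g : Tube → Tube} (hf : IsSmoothImmersion f)
    (hg : IsSmoothImmersion g) : IsSmoothImmersion (f ∘ g) := by
  obtain ⟨F, hF, hFf, hF'⟩ := hf
  obtain ⟨G, hG, hGg, hG'⟩ := hg
  refine ⟨F ∘ G, hF.comp hG, fun p => by simp [hGg, hFf], fun p => ?_⟩
  rw [fderiv_comp _ ((hF.differentiable (by simp)) _) ((hG.differentiable (by simp)) _), hGg]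
  exact (hF' (g p)).comp (hG' p)

theorem isSmoothImmersion_of_affine (c d e : ℝ) (w : ℂ) (hc : c ≠ 0) (he : e ≠ 0)
    {f : Tube → Tube} (hf : ∀ p, incl (f p) = (c * p.1 + d, e • (p.2 : ℂ) + w)) :
    IsSmoothImmersion f := by
  let A : ℝ × ℂ →L[ℝ] ℝ × ℂ :=
    (c • ContinuousLinearMap.fst ℝ ℝ ℂ).prod (e • ContinuousLinearMap.snd ℝ ℝ ℂ)
  refine ⟨fun q => A q + (d, w), A.contDiff.add contDiff_const, fun p => ?_, fun p => ?_⟩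
  · rw [hf]
    simp [A, incl]
  · rw [fderiv_add_const, ContinuousLinearMap.fderiv]
    intro x y h
    simp only [A, ContinuousLinearMap.prod_apply, smul_apply,
      ContinuousLinearMap.coe_fst', ContinuousLinearMap.coe_snd', Prod.mk.injEq, smul_eq_mul] at h
    exact Prod.ext (mul_left_cancel₀ hc h.1) (smul_right_injective _ he h.2)

theorem isSmoothImmersion_id : IsSmoothImmersion id :=
  isSmoothImmersion_of_affine 1 0 1 0 one_ne_zero one_ne_zero fun p => by simp [incl]

/-! ## Framed long knots -/

/-- A framed long knot: a smooth embedding `ℝ × D² → ℝ × D²` that restricts to the identity outside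
of `[-1, 1] × D²`. -/
@[ext] structure FramedLongKnot where
  toFun : Tube → Tube
  immersion : IsSmoothImmersion toFun
  embedding : IsEmbedding toFun
  eq_id : ∀ p, p.1 ∉ Icc (-1 : ℝ) 1 → toFun p = p

instance : CoeFun FramedLongKnot fun _ => Tube → Tube := ⟨FramedLongKnot.toFun⟩

/-- Framed long knots form a monoid under composition. -/
instance : Monoid FramedLongKnot where
  one := ⟨id, isSmoothImmersion_id, IsEmbedding.id, fun _ _ => rfl⟩
  mul f g := ⟨f.toFun ∘ g.toFun, f.immersion.comp g.immersion, f.embedding.comp g.embedding,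
    fun p hp => by simp [g.eq_id p hp, f.eq_id p hp]⟩
  one_mul _ := rfl
  mul_one _ := rfl
  mul_assoc _ _ _ := rfl

theorem FramedLongKnot.mul_apply (f g : FramedLongKnot) (p : Tube) : (f * g) p = f (g p) := rfl

theorem FramedLongKnot.one_apply (p : Tube) : (1 : FramedLongKnot) p = p := rfl

/-- Two continuous functions of a real variable that agree outside of `[a, b]` also agree at the
end points. -/
theorem eq_of_eq_outside {Y : Type*} [TopologicalSpace Y] [T2Space Y] {g h : ℝ → Y}
    (hg : Continuous g) (hh : Continuous h) {a b : ℝ} (H : ∀ t, t ∉ Icc a b → g t = h t)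
    {t : ℝ} (ht : t ∉ Ioo a b) : g t = h t := by
  have h1 : EqOn g h (closure (Icc a b)ᶜ) := EqOn.closure (fun t ht => H t ht) hg hh
  rw [closure_compl, interior_Icc] at h1
  exact h1 ht

theorem FramedLongKnot.eq_id' (f : FramedLongKnot) (p : Tube) (hp : p.1 ∉ Ioo (-1 : ℝ) 1) :
    f p = p :=
  eq_of_eq_outside (g := fun t => f (t, p.2)) (h := fun t => (t, p.2))
    (f.immersion.continuous.comp (by fun_prop)) (by fun_prop) (fun t ht => f.eq_id (t, p.2) ht) hp

theorem FramedLongKnot.mem_Ioo (f : FramedLongKnot) (p : Tube) (hp : p.1 ∈ Ioo (-1 : ℝ) 1) :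
    (f p).1 ∈ Ioo (-1 : ℝ) 1 := by
  by_contra h
  have h1 := f.embedding.injective (f.eq_id' (f p) h)
  rw [h1] at h
  exact h hp

/-! ## Framed string 2-links

The two strands are indexed by the two summands of `(ℝ × D²) ⊔ (ℝ × D²)`: `inl` is the upper strand
and `inr` the lower one. -/

theorem half_I_norm : ‖(Complex.I / 2 : ℂ)‖ = 1 / 2 := by simp

/-- The embedding of the disc in itself as the disc of radius `1/8` centered at `(0, 1/2)`. -/
noncomputable def iotaUp (z : Metric.closedBall (0 : ℂ) 1) : Metric.closedBall (0 : ℂ) 1 :=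
  ⟨(1 / 8 : ℝ) • (z : ℂ) + Complex.I / 2, by
    have hz : ‖(z : ℂ)‖ ≤ 1 := mem_closedBall_zero_iff.mp z.2
    rw [mem_closedBall_zero_iff]
    refine (norm_add_le _ _).trans ?_
    rw [norm_smul, half_I_norm, Real.norm_of_nonneg (by norm_num)]
    linarith⟩

/-- The embedding of the disc in itself as the disc of radius `1/8` centered at `(0, -1/2)`. -/
noncomputable def iotaDown (z : Metric.closedBall (0 : ℂ) 1) : Metric.closedBall (0 : ℂ) 1 :=
  ⟨(1 / 8 : ℝ) • (z : ℂ) + -(Complex.I / 2), by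
    have hz : ‖(z : ℂ)‖ ≤ 1 := mem_closedBall_zero_iff.mp z.2
    rw [mem_closedBall_zero_iff]
    refine (norm_add_le _ _).trans ?_
    rw [norm_smul, norm_neg, half_I_norm, Real.norm_of_nonneg (by norm_num)]
    linarith⟩

/-- The standard embedding `id × ι` of `(ℝ × D²) ⊔ (ℝ × D²)` in `ℝ × D²`. -/
noncomputable def std : Tube ⊕ Tube → Tube :=
  Sum.elim (fun p => (p.1, iotaUp p.2)) (fun p => (p.1, iotaDown p.2))

/-- The first coordinate of a point of `(ℝ × D²) ⊔ (ℝ × D²)`. -/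
def height : Tube ⊕ Tube → ℝ := Sum.elim Prod.fst Prod.fst

/-- A framed string 2-link: a smooth embedding `(ℝ × D²) ⊔ (ℝ × D²) → ℝ × D²` that restricts to the
standard embedding outside of `([-1, 1] × D²) ⊔ ([-1, 1] × D²)` and maps the interior of
`([-1, 1] × D²) ⊔ ([-1, 1] × D²)` in the interior of `[-1, 1] × D²` (interiors relative to
`ℝ × D²`). -/
@[ext] structure FramedStringLink where
  toFun : Tube ⊕ Tube → Tube
  immersion_up : IsSmoothImmersion (toFun ∘ Sum.inl)
  immersion_down : IsSmoothImmersion (toFun ∘ Sum.inr)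
  embedding : IsEmbedding toFun
  eq_std : ∀ p, height p ∉ Icc (-1 : ℝ) 1 → toFun p = std p
  mem_Ioo : ∀ p, height p ∈ Ioo (-1 : ℝ) 1 → (toFun p).1 ∈ Ioo (-1 : ℝ) 1

instance : CoeFun FramedStringLink fun _ => Tube ⊕ Tube → Tube := ⟨FramedStringLink.toFun⟩

theorem height_inl (p : Tube) : height (Sum.inl p) = p.1 := rfl
theorem height_inr (p : Tube) : height (Sum.inr p) = p.1 := rfl
theorem std_inl (p : Tube) : std (Sum.inl p) = (p.1, iotaUp p.2) := rfl
theorem std_inr (p : Tube) : std (Sum.inr p) = (p.1, iotaDown p.2) := rfl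
theorem std_fst (p : Tube ⊕ Tube) : (std p).1 = height p := by cases p <;> rfl

theorem isSmoothImmersion_std_up : IsSmoothImmersion (std ∘ Sum.inl) :=
  isSmoothImmersion_of_affine 1 0 (1 / 8) (Complex.I / 2) one_ne_zero (by norm_num)
    fun p => by simp [incl, std_inl, iotaUp]

theorem isSmoothImmersion_std_down : IsSmoothImmersion (std ∘ Sum.inr) :=
  isSmoothImmersion_of_affine 1 0 (1 / 8) (-(Complex.I / 2)) one_ne_zero (by norm_num)
    fun p => by simp [incl, std_inr, iotaDown]

theorem std_injective : Function.Injective std := by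
  have key : ∀ z w : Metric.closedBall (0 : ℂ) 1, iotaUp z ≠ iotaDown w := by
    intro z w h
    have hz : ‖(z : ℂ)‖ ≤ 1 := mem_closedBall_zero_iff.mp z.2
    have hw : ‖(w : ℂ)‖ ≤ 1 := mem_closedBall_zero_iff.mp w.2
    have h1 := congrArg (fun u : Metric.closedBall (0 : ℂ) 1 => (u : ℂ).im) h
    have h2 := (abs_le.mp ((Complex.abs_im_le_norm (z : ℂ)).trans hz)).1
    have h3 := (abs_le.mp ((Complex.abs_im_le_norm (w : ℂ)).trans hw)).2
    simp [iotaUp, iotaDown] at h1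
    linarith
  rintro (p | p) (q | q) h
  · simp only [std_inl, Prod.mk.injEq, iotaUp, Subtype.mk.injEq, add_left_inj] at h
    exact congrArg _ (Prod.ext h.1 (Subtype.ext (smul_right_injective ℂ (by norm_num) h.2)))
  · exact absurd (congrArg Prod.snd h) (key _ _)
  · exact absurd (congrArg Prod.snd h).symm (key _ _)
  · simp only [std_inr, Prod.mk.injEq, iotaDown, Subtype.mk.injEq, add_left_inj] at h
    exact congrArg _ (Prod.ext h.1 (Subtype.ext (smul_right_injective ℂ (by norm_num) h.2)))

theorem continuous_height : Continuous height := by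
  rw [continuous_sum_dom]
  exact ⟨continuous_fst, continuous_fst⟩

theorem eq_std_of_notMem_Ioo {f : Tube ⊕ Tube → Tube} (hf : Continuous f) {a b : ℝ}
    (h : ∀ p, height p ∉ Icc a b → f p = std p) (p : Tube ⊕ Tube) (hp : height p ∉ Ioo a b) :
    f p = std p := by
  have hs : Continuous std := by
    rw [continuous_sum_dom]
    exact ⟨isSmoothImmersion_std_up.continuous, isSmoothImmersion_std_down.continuous⟩
  rcases p with p | p
  · exact eq_of_eq_outside (g := fun t => f (.inl (t, p.2))) (h := fun t => std (.inl (t, p.2)))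
      (by fun_prop) (by fun_prop) (fun t ht => h _ ht) hp
  · exact eq_of_eq_outside (g := fun t => f (.inr (t, p.2))) (h := fun t => std (.inr (t, p.2)))
      (by fun_prop) (by fun_prop) (fun t ht => h _ ht) hp

theorem FramedStringLink.eq_std' (f : FramedStringLink) (p : Tube ⊕ Tube)
    (hp : height p ∉ Ioo (-1 : ℝ) 1) : f p = std p :=
  eq_std_of_notMem_Ioo f.embedding.continuous f.eq_std p hp

/-- An injective continuous map that is standard outside of a compact set is an embedding. -/
theorem isEmbedding_of_eq_std {f : Tube ⊕ Tube → Tube} (hf : Continuous f)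
    (hinj : Function.Injective f) (h : ∀ p, height p ∉ Icc (-1 : ℝ) 1 → f p = std p) :
    IsEmbedding f := by
  refine (IsClosedEmbedding.of_continuous_injective_isClosedMap hf hinj
    (IsProperMap.isClosedMap ?_)).isEmbedding
  refine isProperMap_iff_isCompact_preimage.mpr ⟨hf, fun {K} hK => ?_⟩
  obtain ⟨R, hR⟩ := (hK.image continuous_fst).isBounded.subset_closedBall 0
  have hc : IsCompact (Icc (-(max R 1)) (max R 1) ×ˢ
      (univ : Set (Metric.closedBall (0 : ℂ) 1))) := isCompact_Icc.prod isCompact_univ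
  refine ((hc.image continuous_inl).union (hc.image continuous_inr)).of_isClosed_subset
    (hK.isClosed.preimage hf) ?_
  intro p hp
  have hh : height p ∈ Icc (-(max R 1)) (max R 1) := by
    by_cases hI : height p ∈ Icc (-1 : ℝ) 1
    · exact ⟨by linarith [hI.1, le_max_right R 1], by linarith [hI.2, le_max_right R 1]⟩
    · have h1 : (f p).1 ∈ Metric.closedBall (0 : ℝ) R := hR ⟨f p, hp, rfl⟩
      rw [h p hI, std_fst, mem_closedBall_zero_iff, Real.norm_eq_abs] at h1
      exact abs_le.mp (h1.trans (le_max_left _ _))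
  rcases p with p | p
  · exact Or.inl ⟨p, ⟨hh, mem_univ _⟩, rfl⟩
  · exact Or.inr ⟨p, ⟨hh, mem_univ _⟩, rfl⟩

/-- The map `k ∘ l ∘ (kUp ⊔ kDown)`. -/
noncomputable def FramedStringLink.compose (k : FramedLongKnot) (l : FramedStringLink)
    (kUp kDown : FramedLongKnot) : FramedStringLink where
  toFun := k ∘ l ∘ Sum.map kUp kDown
  immersion_up := k.immersion.comp (l.immersion_up.comp kUp.immersion)
  immersion_down := k.immersion.comp (l.immersion_down.comp kDown.immersion)
  embedding := by
    refine isEmbedding_of_eq_std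
      (k.embedding.continuous.comp (l.embedding.continuous.comp
        (kUp.embedding.continuous.sumMap kDown.embedding.continuous)))
      (k.embedding.injective.comp (l.embedding.injective.comp
        (kUp.embedding.injective.sumMap kDown.embedding.injective))) ?_
    rintro (p | p) hp
    · simp only [Function.comp_apply, Sum.map_inl, kUp.eq_id p hp, l.eq_std _ hp]
      exact k.eq_id _ hp
    · simp only [Function.comp_apply, Sum.map_inr, kDown.eq_id p hp, l.eq_std _ hp]
      exact k.eq_id _ hp
  eq_std := by
    rintro (p | p) hp
    · simp only [Function.comp_apply, Sum.map_inl, kUp.eq_id p hp, l.eq_std _ hp]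
      exact k.eq_id _ hp
    · simp only [Function.comp_apply, Sum.map_inr, kDown.eq_id p hp, l.eq_std _ hp]
      exact k.eq_id _ hp
  mem_Ioo := by
    rintro (p | p) hp
    · exact k.mem_Ioo _ (l.mem_Ioo _ (kUp.mem_Ioo _ hp))
    · exact k.mem_Ioo _ (l.mem_Ioo _ (kDown.mem_Ioo _ hp))

/-! ## Little intervals, little squares and the affine actions -/

/-- A little 1-cube: an affine increasing map `x ↦ a x + b` that maps `[-1, 1]` into itself. -/
@[ext] structure LittleInterval where
  a : ℝ
  b : ℝ
  pos : 0 < a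
  left : -1 ≤ -a + b
  right : a + b ≤ 1

namespace LittleInterval

/-- The natural extension of a little 1-cube to the real line. -/
def map (l : LittleInterval) (x : ℝ) : ℝ := l.a * x + l.b

/-- The inverse of the affine map. -/
noncomputable def inv (l : LittleInterval) (x : ℝ) : ℝ := l.a⁻¹ * x + -(l.a⁻¹ * l.b)

/-- The image of `[-1, 1]`. -/
def image (l : LittleInterval) : Set ℝ := l.map '' Icc (-1) 1

theorem map_inv (l : LittleInterval) (x : ℝ) : l.map (l.inv x) = x := by
  have := l.pos.ne'
  simp only [map, inv]
  field_simp
  ring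

theorem inv_map (l : LittleInterval) (x : ℝ) : l.inv (l.map x) = x := by
  have := l.pos.ne'
  simp only [map, inv]
  field_simp
  ring

theorem map_lt_map (l : LittleInterval) {x y : ℝ} : l.map x < l.map y ↔ x < y := by
  simp [map, l.pos]

theorem map_le_map (l : LittleInterval) {x y : ℝ} : l.map x ≤ l.map y ↔ x ≤ y := by
  simp [map, l.pos]

theorem map_mem_Ioo (l : LittleInterval) {x : ℝ} :
    l.map x ∈ Ioo (l.map (-1)) (l.map 1) ↔ x ∈ Ioo (-1 : ℝ) 1 := by
  simp [l.map_lt_map]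

theorem inv_mem_Ioo (l : LittleInterval) {x : ℝ} :
    l.inv x ∈ Ioo (-1 : ℝ) 1 ↔ x ∈ Ioo (l.map (-1)) (l.map 1) := by
  rw [← l.map_mem_Ioo, l.map_inv]

theorem inv_mem_Icc (l : LittleInterval) {x : ℝ} :
    l.inv x ∈ Icc (-1 : ℝ) 1 ↔ x ∈ Icc (l.map (-1)) (l.map 1) := by
  rw [mem_Icc, ← l.map_le_map (x := -1), ← l.map_le_map (y := 1), l.map_inv, mem_Icc]

theorem image_eq (l : LittleInterval) : l.image = Icc (l.map (-1)) (l.map 1) := by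
  ext x
  rw [← l.inv_mem_Icc]
  exact ⟨fun ⟨y, hy, h⟩ => h ▸ (l.inv_map y).symm ▸ hy, fun h => ⟨_, h, l.map_inv x⟩⟩

theorem interior_image (l : LittleInterval) :
    interior l.image = Ioo (l.map (-1)) (l.map 1) := by
  rw [image_eq, interior_Icc]

theorem neg_one_le (l : LittleInterval) : -1 ≤ l.map (-1) := by
  simpa [map] using l.left

theorem le_one (l : LittleInterval) : l.map 1 ≤ 1 := by
  simpa [map] using l.right

theorem Ioo_subset (l : LittleInterval) :
    Ioo (l.map (-1)) (l.map 1) ⊆ Ioo (-1 : ℝ) 1 := Ioo_subset_Ioo l.neg_one_le l.le_one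

theorem Icc_subset (l : LittleInterval) :
    Icc (l.map (-1)) (l.map 1) ⊆ Icc (-1 : ℝ) 1 := Icc_subset_Icc l.neg_one_le l.le_one

/-- The map `l × id` of the tube. -/
def tube (l : LittleInterval) (p : Tube) : Tube := (l.map p.1, p.2)

/-- The map `l⁻¹ × id` of the tube. -/
noncomputable def tubeInv (l : LittleInterval) (p : Tube) : Tube := (l.inv p.1, p.2)

theorem tube_tubeInv (l : LittleInterval) (p : Tube) : l.tube (l.tubeInv p) = p := by
  simp [tube, tubeInv, map_inv]

theorem tubeInv_tube (l : LittleInterval) (p : Tube) : l.tubeInv (l.tube p) = p := by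
  simp [tube, tubeInv, inv_map]

theorem continuous_tube (l : LittleInterval) : Continuous l.tube := by
  unfold tube map; fun_prop

theorem continuous_tubeInv (l : LittleInterval) : Continuous l.tubeInv := by
  unfold tubeInv inv; fun_prop

/-- `l × id` as a homeomorphism of the tube. -/
noncomputable def tubeHomeo (l : LittleInterval) : Tube ≃ₜ Tube where
  toFun := l.tube
  invFun := l.tubeInv
  left_inv := l.tubeInv_tube
  right_inv := l.tube_tubeInv
  continuous_toFun := l.continuous_tube
  continuous_invFun := l.continuous_tubeInv

theorem isEmbedding_tube (l : LittleInterval) : IsEmbedding l.tube :=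
  l.tubeHomeo.isEmbedding

theorem isEmbedding_tubeInv (l : LittleInterval) : IsEmbedding l.tubeInv :=
  l.tubeHomeo.symm.isEmbedding

theorem isSmoothImmersion_tube (l : LittleInterval) : IsSmoothImmersion l.tube :=
  isSmoothImmersion_of_affine l.a l.b 1 0 l.pos.ne' one_ne_zero
    fun p => by simp [incl, tube, map]

theorem isSmoothImmersion_tubeInv (l : LittleInterval) : IsSmoothImmersion l.tubeInv :=
  isSmoothImmersion_of_affine l.a⁻¹ (-(l.a⁻¹ * l.b)) 1 0 (inv_ne_zero l.pos.ne') one_ne_zero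
    fun p => by simp [incl, tubeInv, inv]

/-- The action of a little 1-cube on a framed long knot: `(l × id) ∘ f ∘ (l⁻¹ × id)`. -/
noncomputable def actKnot (l : LittleInterval) (f : FramedLongKnot) : FramedLongKnot where
  toFun := l.tube ∘ f ∘ l.tubeInv
  immersion := l.isSmoothImmersion_tube.comp (f.immersion.comp l.isSmoothImmersion_tubeInv)
  embedding := l.isEmbedding_tube.comp (f.embedding.comp l.isEmbedding_tubeInv)
  eq_id p hp := by
    have h : (l.tubeInv p).1 ∉ Icc (-1 : ℝ) 1 := fun h => hp (l.Icc_subset (l.inv_mem_Icc.mp h))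
    simp [f.eq_id _ h, tube_tubeInv]

theorem actKnot_apply (l : LittleInterval) (f : FramedLongKnot) (p : Tube) :
    l.actKnot f p = l.tube (f (l.tubeInv p)) := rfl

theorem actKnot_eq_id (l : LittleInterval) (f : FramedLongKnot) (p : Tube)
    (hp : p.1 ∉ Ioo (l.map (-1)) (l.map 1)) : l.actKnot f p = p := by
  have h : (l.tubeInv p).1 ∉ Ioo (-1 : ℝ) 1 := fun h => hp (l.inv_mem_Ioo.mp h)
  rw [actKnot_apply, f.eq_id' _ h, tube_tubeInv]

theorem actKnot_mem_Ioo (l : LittleInterval) (f : FramedLongKnot) (p : Tube)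
    (hp : p.1 ∈ Ioo (l.map (-1)) (l.map 1)) :
    (l.actKnot f p).1 ∈ Ioo (l.map (-1)) (l.map 1) :=
  l.map_mem_Ioo.mpr (f.mem_Ioo (l.tubeInv p) (l.inv_mem_Ioo.mpr hp))

theorem tube_std_tubeInv (l : LittleInterval) (p : Tube ⊕ Tube) :
    l.tube (std (Sum.map l.tubeInv l.tubeInv p)) = std p := by
  rcases p with p | p <;> simp [std_inl, std_inr, tube, tubeInv, map_inv]

theorem height_map_tubeInv (l : LittleInterval) (p : Tube ⊕ Tube) :
    height (Sum.map l.tubeInv l.tubeInv p) = l.inv (height p) := by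
  rcases p with p | p <;> rfl

theorem actLink_eq_std_aux (l : LittleInterval) (f : FramedStringLink) (p : Tube ⊕ Tube)
    (hp : height p ∉ Ioo (l.map (-1)) (l.map 1)) :
    l.tube (f (Sum.map l.tubeInv l.tubeInv p)) = std p := by
  rw [f.eq_std' _ (by rw [height_map_tubeInv, inv_mem_Ioo]; exact hp), tube_std_tubeInv]

theorem actLink_mem_aux (l : LittleInterval) (f : FramedStringLink) (p : Tube ⊕ Tube)
    (hp : height p ∈ Ioo (l.map (-1)) (l.map 1)) :
    (l.tube (f (Sum.map l.tubeInv l.tubeInv p))).1 ∈ Ioo (l.map (-1)) (l.map 1) :=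
  l.map_mem_Ioo.mpr (f.mem_Ioo _ (by rw [height_map_tubeInv, inv_mem_Ioo]; exact hp))

/-- The action of a little 1-cube on a framed string 2-link:
`(l × id) ∘ f ∘ ((l⁻¹ × id) ⊔ (l⁻¹ × id))`. -/
noncomputable def actLink (l : LittleInterval) (f : FramedStringLink) : FramedStringLink where
  toFun := l.tube ∘ f ∘ Sum.map l.tubeInv l.tubeInv
  immersion_up :=
    l.isSmoothImmersion_tube.comp (f.immersion_up.comp l.isSmoothImmersion_tubeInv)
  immersion_down :=
    l.isSmoothImmersion_tube.comp (f.immersion_down.comp l.isSmoothImmersion_tubeInv)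
  embedding := isEmbedding_of_eq_std
    (l.continuous_tube.comp (f.embedding.continuous.comp
      (l.continuous_tubeInv.sumMap l.continuous_tubeInv)))
    (l.isEmbedding_tube.injective.comp (f.embedding.injective.comp
      (l.isEmbedding_tubeInv.injective.sumMap l.isEmbedding_tubeInv.injective)))
    fun p hp => l.actLink_eq_std_aux f p fun h => hp (Ioo_subset_Icc_self (l.Ioo_subset h))
  eq_std p hp := l.actLink_eq_std_aux f p fun h => hp (Ioo_subset_Icc_self (l.Ioo_subset h))
  mem_Ioo p hp := by
    by_cases h : height p ∈ Ioo (l.map (-1)) (l.map 1)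
    · exact l.Ioo_subset (l.actLink_mem_aux f p h)
    · simp only [Function.comp_apply]
      rw [l.actLink_eq_std_aux f p h, std_fst]
      exact hp

theorem actLink_eq_std (l : LittleInterval) (f : FramedStringLink) (p : Tube ⊕ Tube)
    (hp : height p ∉ Ioo (l.map (-1)) (l.map 1)) : l.actLink f p = std p :=
  l.actLink_eq_std_aux f p hp

theorem actLink_mem (l : LittleInterval) (f : FramedStringLink) (p : Tube ⊕ Tube)
    (hp : height p ∈ Ioo (l.map (-1)) (l.map 1)) :
    (l.actLink f p).1 ∈ Ioo (l.map (-1)) (l.map 1) :=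
  l.actLink_mem_aux f p hp

/-- Two little 1-cubes are almost disjoint if the interiors of their images are disjoint. -/
def AlmostDisjoint (l m : LittleInterval) : Prop :=
  Disjoint (interior l.image) (interior m.image)

end LittleInterval

/-- A little 2-cube: a product `x × y` of two little 1-cubes. -/
@[ext] structure LittleSquare where
  x : LittleInterval
  y : LittleInterval

namespace LittleSquare

/-- The image of `[-1, 1]²`. -/
def image (L : LittleSquare) : Set (ℝ × ℝ) := Prod.map L.x.map L.y.map '' (Icc (-1) 1 ×ˢ Icc (-1) 1)

/-- Two little 2-cubes are almost disjoint if the interiors of their images are disjoint. -/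
def AlmostDisjoint (L P : LittleSquare) : Prop := Disjoint (interior L.image) (interior P.image)

/-- The little 2-cube meets the lower face of the unit square. -/
def MeetsLowerFace (L : LittleSquare) : Prop := L.y.map (-1) = -1

theorem interior_image (L : LittleSquare) :
    interior L.image = interior L.x.image ×ˢ interior L.y.image := by
  rw [image, prodMap_image_prod, interior_prod_eq]
  rfl

theorem AlmostDisjoint.x_of_meetsLowerFace {L P : LittleSquare} (h : L.AlmostDisjoint P)
    (hL : L.MeetsLowerFace) (hP : P.MeetsLowerFace) : L.x.AlmostDisjoint P.x := by
  rw [AlmostDisjoint, interior_image, interior_image, Set.disjoint_prod] at h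
  refine h.resolve_right fun hy => ?_
  rw [LittleInterval.interior_image, LittleInterval.interior_image, hL, hP,
    Ioo_disjoint_Ioo] at hy
  have h1 := L.y.map_lt_map.mpr (show (-1 : ℝ) < 1 by norm_num)
  have h2 := P.y.map_lt_map.mpr (show (-1 : ℝ) < 1 by norm_num)
  rw [hL] at h1
  rw [hP] at h2
  simp only [max_self, min_le_iff] at hy
  rcases hy with hy | hy <;> linarith

end LittleSquare

/-! ## The actions on framed long knots and on framed string 2-links -/

section Kappa

variable {ι : Type}

/-- The generating relation of the order on little 2-cubes: `L` starts strictly below `P`, and the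
interiors of their projections to the first coordinate meet. -/
def LittleSquare.Below (L P : LittleSquare) : Prop :=
  L.y.map (-1) < P.y.map (-1) ∧ (interior L.x.image ∩ interior P.x.image).Nonempty

/-- The strict partial order on (the indices of) a family of little 2-cubes. -/
def Precedes (L : ι → LittleSquare) : ι → ι → Prop :=
  Relation.TransGen fun i j => (L i).Below (L j)

/-- The list `l = [σ 1, …, σ k]` enumerates the indices, each once, and orders the little 2-cubes:
no cube is preceded by a later one of the list. -/
structure Orders (L : ι → LittleSquare) (l : List ι) : Prop where
  nodup : l.Nodup
  mem : ∀ i, i ∈ l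
  pairwise : l.Pairwise fun i j => ¬ Precedes L j i

theorem Precedes.lt {L : ι → LittleSquare} {i j : ι} (h : Precedes L i j) :
    (L i).y.map (-1) < (L j).y.map (-1) := by
  induction h with
  | single h => exact h.1
  | tail _ h ih => exact ih.trans h.1

theorem exists_orders [Fintype ι] (L : ι → LittleSquare) : ∃ l, Orders L l := by
  classical
  let r : ι → ι → Prop := fun i j => (L i).y.map (-1) ≤ (L j).y.map (-1)
  have : Std.Total r := ⟨fun i j => le_total _ _⟩
  have : IsTrans ι r := ⟨fun i j k => le_trans⟩
  have hp := List.perm_insertionSort r (Finset.univ : Finset ι).toList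
  refine ⟨_, hp.nodup_iff.mpr (Finset.nodup_toList _), fun i => hp.mem_iff.mpr (by simp), ?_⟩
  exact (List.pairwise_insertionSort r _).imp fun {i j} hij h => (not_lt.mpr hij) (Precedes.lt h)

/-- The composite `(L^{σ 1} f_{σ 1}) ∘ ⋯ ∘ (L^{σ k} f_{σ k})`, where `L^i` acts through its
projection to the first coordinate. -/
noncomputable def kappaList (L : ι → LittleSquare) (f : ι → FramedLongKnot) (l : List ι) :
    FramedLongKnot :=
  (l.map fun i => (L i).x.actKnot (f i)).prod

/-- Budney's action on framed long knots: the composite in an order that is non-decreasing for the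
partial order of the little 2-cubes. -/
noncomputable def kappa [Fintype ι] (L : ι → LittleSquare) (f : ι → FramedLongKnot) : FramedLongKnot :=
  kappaList L f (exists_orders L).choose

/-- Budney's reverse action: the composite in a non-increasing order. -/
noncomputable def kappaRev [Fintype ι] (L : ι → LittleSquare) (f : ι → FramedLongKnot) : FramedLongKnot :=
  kappaList L f (exists_orders L).choose.reverse

theorem actKnot_commute {l m : LittleInterval} (h : l.AlmostDisjoint m) (f g : FramedLongKnot) :
    l.actKnot f * m.actKnot g = m.actKnot g * l.actKnot f := by
  rw [LittleInterval.AlmostDisjoint, l.interior_image, m.interior_image] at h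
  refine FramedLongKnot.ext (funext fun p => ?_)
  change l.actKnot f (m.actKnot g p) = m.actKnot g (l.actKnot f p)
  by_cases hl : p.1 ∈ Ioo (l.map (-1)) (l.map 1)
  · have hm := disjoint_left.mp h hl
    rw [m.actKnot_eq_id g p hm,
      m.actKnot_eq_id g _ (disjoint_left.mp h (l.actKnot_mem_Ioo f p hl))]
  · rw [l.actKnot_eq_id f p hl]
    by_cases hm : p.1 ∈ Ioo (m.map (-1)) (m.map 1)
    · exact l.actKnot_eq_id f _ (disjoint_right.mp h (m.actKnot_mem_Ioo g p hm))
    · rw [m.actKnot_eq_id g p hm, l.actKnot_eq_id f p hl]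

theorem prod_eq_of_pairwise {M : Type*} [Monoid M] (φ : ι → M) (R : ι → ι → Prop)
    (hR : ∀ i j, i ≠ j → ¬ R i j → ¬ R j i → φ i * φ j = φ j * φ i) (l : List ι) :
    ∀ l' : List ι, l.Nodup → l.Perm l' → l.Pairwise (fun i j => ¬ R j i) →
      l'.Pairwise (fun i j => ¬ R j i) → (l.map φ).prod = (l'.map φ).prod := by
  induction l with
  | nil =>
    intro l' _ hp _ _
    rw [List.nil_perm.mp hp]
  | cons a l ih =>
    intro l' hn hp h1 h2
    obtain ⟨u, v, rfl⟩ := List.append_of_mem (hp.mem_iff.mp List.mem_cons_self)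
    have hp' : l.Perm (u ++ v) := (hp.trans List.perm_middle).cons_inv
    rw [List.nodup_cons] at hn
    rw [List.pairwise_cons] at h1
    rw [List.pairwise_append, List.pairwise_cons] at h2
    have h3 : (u ++ v).Pairwise (fun i j => ¬ R j i) := by
      rw [List.pairwise_append]
      exact ⟨h2.1, h2.2.1.2, fun x hx y hy => h2.2.2 x hx y (List.mem_cons_of_mem _ hy)⟩
    have hc : Commute (φ a) (u.map φ).prod := by
      refine Commute.list_prod_right _ _ fun x hx => ?_
      obtain ⟨i, hi, rfl⟩ := List.mem_map.mp hx
      have hil : i ∈ l := hp'.mem_iff.mpr (List.mem_append_left _ hi)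
      exact hR a i (fun h => hn.1 (h ▸ hil)) (h2.2.2 i hi a List.mem_cons_self) (h1.1 i hil)
    rw [List.map_cons, List.prod_cons, ih _ hn.2 hp' h1.2 h3]
    simp only [List.map_append, List.map_cons, List.prod_append, List.prod_cons]
    rw [← mul_assoc, hc.eq, mul_assoc]

/-- For pairwise almost disjoint little 2-cubes, the composite does not depend on the order that
is chosen; in particular `kappa` is the composite along any of them. -/
theorem kappaList_eq {L : ι → LittleSquare} (hL : Pairwise fun i j => (L i).AlmostDisjoint (L j))
    (f : ι → FramedLongKnot) {l l' : List ι} (hl : Orders L l) (hl' : Orders L l') :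
    kappaList L f l = kappaList L f l' := by
  refine prod_eq_of_pairwise (fun i => (L i).x.actKnot (f i)) (Precedes L) ?_ l l' hl.nodup
    ((List.perm_ext_iff_of_nodup hl.nodup hl'.nodup).mpr fun i => by simp [hl.mem, hl'.mem])
    hl.pairwise hl'.pairwise
  intro i j hij h1 h2
  refine actKnot_commute ?_ _ _
  rw [LittleInterval.AlmostDisjoint, Set.disjoint_iff_inter_eq_empty, ← not_nonempty_iff_eq_empty]
  intro hne
  rcases lt_trichotomy ((L i).y.map (-1)) ((L j).y.map (-1)) with h | h | h
  · exact h1 (.single ⟨h, hne⟩)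
  · have hd : (L i).AlmostDisjoint (L j) := hL hij
    rw [LittleSquare.AlmostDisjoint, LittleSquare.interior_image, LittleSquare.interior_image,
      Set.disjoint_prod] at hd
    rcases hd with hd | hd
    · exact hne.ne_empty hd.inter_eq
    · rw [LittleInterval.interior_image, LittleInterval.interior_image, Ioo_disjoint_Ioo, h] at hd
      have e1 := (L i).y.map_lt_map.mpr (show (-1 : ℝ) < 1 by norm_num)
      have e2 := (L j).y.map_lt_map.mpr (show (-1 : ℝ) < 1 by norm_num)
      simp only [max_self, min_le_iff] at hd
      rcases hd with hd | hd <;> linarith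
  · exact h2 (.single ⟨h, by rwa [inter_comm]⟩)

theorem kappa_eq [Fintype ι] {L : ι → LittleSquare} (hL : Pairwise fun i j => (L i).AlmostDisjoint (L j))
    (f : ι → FramedLongKnot) {l : List ι} (hl : Orders L l) :
    kappa L f = (l.map fun i => (L i).x.actKnot (f i)).prod :=
  kappaList_eq hL f (exists_orders L).choose_spec hl

end Kappa

section Lambda

variable {ι : Type} [Fintype ι]

open Classical in
/-- The underlying map of the concatenation: `L^i f_i` at the points whose first coordinate lies
in the interval `L^i`, standard elsewhere. (Two of the intervals share at most an end point, where
both prescriptions are standard.) -/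
noncomputable def lambdaFun (l : ι → LittleInterval) (f : ι → FramedStringLink)
    (p : Tube ⊕ Tube) : Tube :=
  if h : ∃ i, height p ∈ (l i).image then (l h.choose).actLink (f h.choose) p else std p

theorem LittleInterval.AlmostDisjoint.notMem_Icc {l m : LittleInterval} (h : l.AlmostDisjoint m)
    {x : ℝ} (hx : x ∈ Ioo (l.map (-1)) (l.map 1)) : x ∉ Icc (m.map (-1)) (m.map 1) := by
  rw [LittleInterval.AlmostDisjoint, l.interior_image, m.interior_image] at h
  have h1 := h.closure_right isOpen_Ioo
  rw [closure_Ioo (m.map_lt_map.mpr (by norm_num)).ne] at h1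
  exact disjoint_left.mp h1 hx

theorem lambdaFun_of_mem {l : ι → LittleInterval}
    (hl : Pairwise fun i j => (l i).AlmostDisjoint (l j)) (f : ι → FramedStringLink) (i : ι) (p : Tube ⊕ Tube)
    (hp : height p ∈ Ioo ((l i).map (-1)) ((l i).map 1)) :
    lambdaFun l f p = (l i).actLink (f i) p := by
  have h : ∃ i, height p ∈ (l i).image :=
    ⟨i, by rw [LittleInterval.image_eq]; exact Ioo_subset_Icc_self hp⟩
  rw [lambdaFun, dif_pos h]
  have hi : h.choose = i := by
    by_contra hne
    have h2 := h.choose_spec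
    rw [LittleInterval.image_eq] at h2
    exact (hl (Ne.symm hne)).notMem_Icc hp h2
  rw [hi]

theorem lambdaFun_of_notMem (f : ι → FramedStringLink) (l : ι → LittleInterval) (p : Tube ⊕ Tube)
    (hp : ∀ i, height p ∉ Ioo ((l i).map (-1)) ((l i).map 1)) : lambdaFun l f p = std p := by
  rw [lambdaFun]
  split_ifs with h
  · exact (l _).actLink_eq_std _ p (hp _)
  · rfl

/-- On the image of each little interval, `lambdaFun` is `L^i f_i`. -/
theorem lambdaFun_of_mem_image {l : ι → LittleInterval}
    (hl : Pairwise fun i j => (l i).AlmostDisjoint (l j)) (f : ι → FramedStringLink) (i : ι) (p : Tube ⊕ Tube) (hp : height p ∈ (l i).image) :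
    lambdaFun l f p = (l i).actLink (f i) p := by
  by_cases h : height p ∈ Ioo ((l i).map (-1)) ((l i).map 1)
  · exact lambdaFun_of_mem hl f i p h
  · rw [(l i).actLink_eq_std _ p h]
    refine lambdaFun_of_notMem f l p fun j hj => ?_
    rw [LittleInterval.image_eq] at hp
    rcases eq_or_ne j i with rfl | hne
    · exact h hj
    · exact (hl hne).notMem_Icc hj hp

theorem uniqueDiffOn_range_incl : UniqueDiffOn ℝ (range incl) := by
  have h : range incl = univ ×ˢ Metric.closedBall (0 : ℂ) 1 := by
    ext q
    constructor
    · rintro ⟨p, rfl⟩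
      exact ⟨mem_univ _, p.2.2⟩
    · rintro ⟨-, hq⟩
      exact ⟨(q.1, ⟨q.2, hq⟩), rfl⟩
  rw [h]
  refine uniqueDiffOn_convex (convex_univ.prod (convex_closedBall _ _)) ?_
  rw [interior_prod_eq, interior_univ, interior_closedBall _ one_ne_zero]
  exact ⟨(0, 0), mem_univ _, by simp⟩

/-- If two smooth maps agree at the points of the tube whose first coordinate is outside of
`[a, b]`, then so do their differentials, also at the end points. -/
theorem fderiv_eq_of_eq_outside {F G : ℝ × ℂ → ℝ × ℂ} (hF : ContDiff ℝ ∞ F) (hG : ContDiff ℝ ∞ G)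
    {a b : ℝ} (h : ∀ p : Tube, p.1 ∉ Icc a b → F (incl p) = G (incl p)) (p : Tube)
    (hp : p.1 ∉ Ioo a b) : fderiv ℝ F (incl p) = fderiv ℝ G (incl p) := by
  have hc : Continuous fun t : ℝ => incl (t, p.2) :=
    isEmbedding_incl.continuous.comp (by fun_prop)
  refine eq_of_eq_outside (g := fun t => fderiv ℝ F (incl (t, p.2)))
    (h := fun t => fderiv ℝ G (incl (t, p.2))) ((hF.continuous_fderiv (by simp)).comp hc)
    ((hG.continuous_fderiv (by simp)).comp hc) (fun t ht => ?_) hp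
  have hu := uniqueDiffOn_range_incl (incl (t, p.2)) (mem_range_self _)
  rw [← ((hF.differentiable (by simp)) _).fderivWithin hu,
    ← ((hG.differentiable (by simp)) _).fderivWithin hu]
  have hev : F =ᶠ[𝓝[range incl] incl (t, p.2)] G := by
    have ho : {q : ℝ × ℂ | q.1 ∉ Icc a b} ∈ 𝓝 (incl (t, p.2)) :=
      (isClosed_Icc.isOpen_compl.preimage continuous_fst).mem_nhds ht
    filter_upwards [mem_nhdsWithin_of_mem_nhds ho, self_mem_nhdsWithin] with q hq hq'
    obtain ⟨p', rfl⟩ := hq'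
    exact h p' hq
  exact hev.fderivWithin_eq (h _ ht)

/-- Smooth immersions that differ from a given one only over intervals with pairwise disjoint
interiors patch to a smooth immersion. -/
theorem isSmoothImmersion_patch (I : ι → ℝ × ℝ)
    (hI : ∀ i j, i ≠ j → Disjoint (Ioo (I i).1 (I i).2) (Ioo (I j).1 (I j).2))
    {s g : Tube → Tube} {f : ι → Tube → Tube} (hs : IsSmoothImmersion s)
    (hf : ∀ i, IsSmoothImmersion (f i)) (hfs : ∀ i p, p.1 ∉ Ioo (I i).1 (I i).2 → f i p = s p)
    (hg : ∀ i p, p.1 ∈ Ioo (I i).1 (I i).2 → g p = f i p)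
    (hgs : ∀ p, (∀ i, p.1 ∉ Ioo (I i).1 (I i).2) → g p = s p) : IsSmoothImmersion g := by
  obtain ⟨S, hS, hSs, hS'⟩ := hs
  choose F hF hFf hF' using hf
  have hzero : ∀ i p, p.1 ∉ Ioo (I i).1 (I i).2 → F i (incl p) - S (incl p) = 0 := by
    intro i p hp
    rw [hFf, hSs, hfs i p hp, sub_self]
  have hzero' : ∀ i p, p.1 ∉ Ioo (I i).1 (I i).2 →
      fderiv ℝ (F i) (incl p) - fderiv ℝ S (incl p) = 0 := by
    intro i p hp
    refine sub_eq_zero.mpr (fderiv_eq_of_eq_outside (hF i) hS (fun q hq => ?_) p hp)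
    exact sub_eq_zero.mp (hzero i q fun h => hq (Ioo_subset_Icc_self h))
  have hd : ∀ p, fderiv ℝ (fun q => S q + ∑ i, (F i q - S q)) (incl p) =
      fderiv ℝ S (incl p) + ∑ i, (fderiv ℝ (F i) (incl p) - fderiv ℝ S (incl p)) := by
    intro p
    have hSd : HasFDerivAt S (fderiv ℝ S (incl p)) (incl p) :=
      ((hS.differentiable (by simp)) _).hasFDerivAt
    refine HasFDerivAt.fderiv (hSd.add (HasFDerivAt.fun_sum fun i _ => ?_))
    exact (((hF i).differentiable (by simp)) _).hasFDerivAt.sub hSd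
  refine ⟨fun q => S q + ∑ i, (F i q - S q),
    hS.add (ContDiff.sum fun i _ => (hF i).sub hS), fun p => ?_, fun p => ?_⟩
  · by_cases h : ∃ i, p.1 ∈ Ioo (I i).1 (I i).2
    · obtain ⟨i, hi⟩ := h
      have hz : ∀ j, j ≠ i → F j (incl p) - S (incl p) = 0 := fun j hj =>
        hzero j p (disjoint_right.mp (hI j i hj) hi)
      beta_reduce
      rw [Fintype.sum_eq_single i hz, hg i p hi, hFf]
      abel
    · push Not at h
      beta_reduce
      rw [Finset.sum_eq_zero fun i _ => hzero i p (h i), hgs p h, hSs, add_zero]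
  · rw [hd]
    by_cases h : ∃ i, p.1 ∈ Ioo (I i).1 (I i).2
    · obtain ⟨i, hi⟩ := h
      have hz : ∀ j, j ≠ i → fderiv ℝ (F j) (incl p) - fderiv ℝ S (incl p) = 0 := fun j hj =>
        hzero' j p (disjoint_right.mp (hI j i hj) hi)
      rw [Fintype.sum_eq_single i hz, add_sub_cancel]
      exact hF' i p
    · push Not at h
      rw [Finset.sum_eq_zero fun i _ => hzero' i p (h i), add_zero]
      exact hS' p

theorem disjoint_Ioo {ι : Type} {l : ι → LittleInterval}
    (hl : Pairwise fun i j => (l i).AlmostDisjoint (l j)) (i j : ι) (hij : i ≠ j) :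
    Disjoint (Ioo ((l i).map (-1)) ((l i).map 1)) (Ioo ((l j).map (-1)) ((l j).map 1)) := by
  have h : (l i).AlmostDisjoint (l j) := hl hij
  rwa [LittleInterval.AlmostDisjoint, (l i).interior_image, (l j).interior_image] at h

theorem isSmoothImmersion_lambda_up {l : ι → LittleInterval}
    (hl : Pairwise fun i j => (l i).AlmostDisjoint (l j)) (f : ι → FramedStringLink) : IsSmoothImmersion (lambdaFun l f ∘ Sum.inl) :=
  isSmoothImmersion_patch (fun i => ((l i).map (-1), (l i).map 1)) (disjoint_Ioo hl)
    isSmoothImmersion_std_up (fun i => ((l i).actLink (f i)).immersion_up)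
    (fun i p hp => (l i).actLink_eq_std (f i) (.inl p) hp)
    (fun i p hp => lambdaFun_of_mem hl f i (.inl p) hp)
    fun p hp => lambdaFun_of_notMem f l (.inl p) hp

theorem isSmoothImmersion_lambda_down {l : ι → LittleInterval}
    (hl : Pairwise fun i j => (l i).AlmostDisjoint (l j)) (f : ι → FramedStringLink) : IsSmoothImmersion (lambdaFun l f ∘ Sum.inr) :=
  isSmoothImmersion_patch (fun i => ((l i).map (-1), (l i).map 1)) (disjoint_Ioo hl)
    isSmoothImmersion_std_down (fun i => ((l i).actLink (f i)).immersion_down)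
    (fun i p hp => (l i).actLink_eq_std (f i) (.inr p) hp)
    (fun i p hp => lambdaFun_of_mem hl f i (.inr p) hp)
    fun p hp => lambdaFun_of_notMem f l (.inr p) hp

theorem lambdaFun_injective {l : ι → LittleInterval}
    (hl : Pairwise fun i j => (l i).AlmostDisjoint (l j)) (f : ι → FramedStringLink) : Function.Injective (lambdaFun l f) := by
  have key : ∀ (p q : Tube ⊕ Tube) (i : ι), height p ∈ Ioo ((l i).map (-1)) ((l i).map 1) →
      lambdaFun l f p = lambdaFun l f q → p = q := by
    intro p q i hi h
    have h1 := (l i).actLink_mem (f i) p hi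
    rw [← lambdaFun_of_mem hl f i p hi, h] at h1
    by_cases hq : ∃ j, height q ∈ Ioo ((l j).map (-1)) ((l j).map 1)
    · obtain ⟨j, hj⟩ := hq
      have h2 := (l j).actLink_mem (f j) q hj
      rw [← lambdaFun_of_mem hl f j q hj] at h2
      have hij : i = j := by
        by_contra hne
        exact disjoint_left.mp (disjoint_Ioo hl i j hne) h1 h2
      subst hij
      rw [lambdaFun_of_mem hl f i p hi, lambdaFun_of_mem hl f i q hj] at h
      exact ((l i).actLink (f i)).embedding.injective h
    · push Not at hq
      rw [lambdaFun_of_notMem f l q hq, std_fst] at h1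
      exact absurd h1 (hq i)
  intro p q h
  by_cases hp : ∃ i, height p ∈ Ioo ((l i).map (-1)) ((l i).map 1)
  · obtain ⟨i, hi⟩ := hp
    exact key p q i hi h
  · by_cases hq : ∃ i, height q ∈ Ioo ((l i).map (-1)) ((l i).map 1)
    · obtain ⟨i, hi⟩ := hq
      exact (key q p i hi h.symm).symm
    · push Not at hp hq
      rw [lambdaFun_of_notMem f l p hp, lambdaFun_of_notMem f l q hq] at h
      exact std_injective h

theorem lambdaFun_eq_std (f : ι → FramedStringLink) (l : ι → LittleInterval) (p : Tube ⊕ Tube)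
    (hp : height p ∉ Icc (-1 : ℝ) 1) : lambdaFun l f p = std p :=
  lambdaFun_of_notMem f l p fun i hi => hp (Ioo_subset_Icc_self ((l i).Ioo_subset hi))

/-- The action of almost disjoint little intervals on framed string 2-links by concatenation. -/
noncomputable def lambda (l : ι → LittleInterval)
    (hl : Pairwise fun i j => (l i).AlmostDisjoint (l j)) (f : ι → FramedStringLink) :
    FramedStringLink where
  toFun := lambdaFun l f
  immersion_up := isSmoothImmersion_lambda_up hl f
  immersion_down := isSmoothImmersion_lambda_down hl f
  embedding := isEmbedding_of_eq_std
    (continuous_sum_dom.mpr ⟨(isSmoothImmersion_lambda_up hl f).continuous,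
      (isSmoothImmersion_lambda_down hl f).continuous⟩)
    (lambdaFun_injective hl f) (lambdaFun_eq_std f l)
  eq_std := lambdaFun_eq_std f l
  mem_Ioo p hp := by
    by_cases h : ∃ i, height p ∈ Ioo ((l i).map (-1)) ((l i).map 1)
    · obtain ⟨i, hi⟩ := h
      rw [lambdaFun_of_mem hl f i p hi]
      exact (l i).Ioo_subset ((l i).actLink_mem (f i) p hi)
    · push Not at h
      rw [lambdaFun_of_notMem f l p h, std_fst]
      exact hp

end Lambda

/-! ## The Swiss cheese operad for links and its action -/

/-- The four colours: open, upper strand, lower strand, both strands. -/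
inductive Color
  | o | up | down | both
  deriving DecidableEq

/-- The operations of the Swiss cheese operad for links with inputs `t` and output `s`. -/
def SCL {n : ℕ} (t : Fin n → Color) : Color → Set (Fin n → LittleSquare)
  | .o => {L | (∀ i, t i = .o → (L i).MeetsLowerFace) ∧
      (∀ i j, i ≠ j → t i = .o → (L i).AlmostDisjoint (L j)) ∧
      (∀ i j, i ≠ j → t i = t j → (L i).AlmostDisjoint (L j))}
  | s => {L | (∀ i, t i = s) ∧ ∀ i j, i ≠ j → (L i).AlmostDisjoint (L j)}

/-- The quadruplet of spaces on which the operad acts. -/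
def X : Color → Type
  | .o => FramedStringLink
  | _ => FramedLongKnot

/-- The entries of `L` whose input colour is `s`. -/
def cubesOf {n : ℕ} (t : Fin n → Color) (L : Fin n → LittleSquare) (s : Color)
    (i : {i // t i = s}) : LittleSquare := L i

/-- The entries of `f` of colour `s`. -/
def entriesOf {n : ℕ} {t : Fin n → Color} (f : ∀ i, X (t i)) (s : Color) (i : {i // t i = s}) :
    X s := i.2 ▸ f i

theorem pairwise_open {n : ℕ} {t : Fin n → Color} {L : Fin n → LittleSquare} (hL : L ∈ SCL t .o) :
    Pairwise fun i j : {i // t i = Color.o} =>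
      (cubesOf t L .o i).x.AlmostDisjoint (cubesOf t L .o j).x :=
  fun i j hij => (hL.2.1 i j (fun h => hij (Subtype.ext h)) i.2).x_of_meetsLowerFace
    (hL.1 i i.2) (hL.1 j j.2)

/-- The action of the Swiss cheese operad for links. On the colours of knots it is Budney's action
(the reverse one for the colour `both`); on the open colour it is
`κ(L_both, f_both) ∘ λ(L_o, f_o) ∘ (κ(L_up, f_up) ⊔ κ(L_down, f_down))`, with the reverse action on
the left. -/
noncomputable def mu {n : ℕ} (t : Fin n → Color) : (s : Color) → (L : Fin n → LittleSquare) →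
    L ∈ SCL t s → (∀ i, X (t i)) → X s
  | .o, L, hL, f =>
    FramedStringLink.compose (kappaRev (cubesOf t L .both) (entriesOf f .both))
      (lambda (fun i => (cubesOf t L .o i).x) (pairwise_open hL) (entriesOf f .o))
      (kappa (cubesOf t L .up) (entriesOf f .up)) (kappa (cubesOf t L .down) (entriesOf f .down))
  | .up, L, _, f => kappa (cubesOf t L .up) (entriesOf f .up)
  | .down, L, _, f => kappa (cubesOf t L .down) (entriesOf f .down)
  | .both, L, _, f => kappaRev (cubesOf t L .both) (entriesOf f .both)

/-- A family of subspaces of `X` forms a sub-algebra: it is closed under all the operations. -/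
def IsSubSCLAlgebra (A : (s : Color) → Set (X s)) : Prop :=
  ∀ (n : ℕ) (t : Fin n → Color) (s : Color) (L : Fin n → LittleSquare) (hL : L ∈ SCL t s)
    (f : ∀ i, X (t i)), (∀ i, f i ∈ A (t i)) → mu t s L hL f ∈ A s

/-! ## Linking and framing numbers -/

/-- The linking number of two disjoint long curves in `ℝ³ = ℝ × ℂ`, by Gauss' integral
`1/(4π) ∬ det(a(s) - b(t), a'(s), b'(t)) / |a(s) - b(t)|³ ds dt`. It is used for smooth curves that
agree with the parallel lines `s ↦ (s, z)`, `t ↦ (t, w)`, `z ≠ w`, outside of a compact set. Then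
the integrand is absolutely integrable, and the value is the integer linking number of the closed
curves obtained by closing up the two curves far away, by disjoint arcs in the plane of the two
lines. -/
noncomputable def linkingNumber (a b : ℝ → ℝ × ℂ) : ℝ :=
  1 / (4 * Real.pi) * ∫ p : ℝ × ℝ,
    Matrix.det !![(a p.1 - b p.2).1, (a p.1 - b p.2).2.re, (a p.1 - b p.2).2.im;
        (deriv a p.1).1, (deriv a p.1).2.re, (deriv a p.1).2.im;
        (deriv b p.2).1, (deriv b p.2).2.re, (deriv b p.2).2.im] /
      √((a p.1 - b p.2).1 ^ 2 + (a p.1 - b p.2).2.re ^ 2 + (a p.1 - b p.2).2.im ^ 2) ^ 3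

/-- The restriction of `f : ℝ × D² → ℝ × D²` to the line `ℝ × {z}`, as a curve in `ℝ³`. -/
def curve (f : Tube → Tube) (z : Metric.closedBall (0 : ℂ) 1) (t : ℝ) : ℝ × ℂ := incl (f (t, z))

/-- The center `(0, 0)` of the disc. -/
def center : Metric.closedBall (0 : ℂ) 1 := ⟨0, by simp⟩

/-- The boundary point `(0, 1)` of the disc. -/
def top : Metric.closedBall (0 : ℂ) 1 := ⟨Complex.I, by simp⟩

/-- The framing number of `f`: the linking number of its restrictions to `ℝ × (0, 0)` and to
`ℝ × (0, 1)`. -/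
noncomputable def framingNumber (f : Tube → Tube) : ℝ :=
  linkingNumber (curve f center) (curve f top)

/-- The fat long knots: the framed long knots with framing number zero. -/
def fatLongKnots : Set FramedLongKnot := {f | framingNumber f = 0}

/-- The fat string 2-links with linking number zero: the framed string 2-links with framing number
`(0, 0)`, the cores of whose strands have linking number zero. -/
def fatStringLinksZero : Set FramedStringLink :=
  {f | framingNumber (f ∘ Sum.inl) = 0 ∧ framingNumber (f ∘ Sum.inr) = 0 ∧
    linkingNumber (curve (f ∘ Sum.inl) center) (curve (f ∘ Sum.inr) center) = 0}

/-- The quadruplet of the fat string 2-links with linking number zero and of three copies of the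
fat long knots. -/
def fatQuadruplet : (s : Color) → Set (X s)
  | .o => fatStringLinksZero
  | .up => fatLongKnots
  | .down => fatLongKnots
  | .both => fatLongKnots

end StringLinks

namespace StringLinks

open Set Topology MeasureTheory Filter
open scoped ContDiff

/-! ## The Gauss kernel -/

/-! All three conditions cutting out the quadruplet are vanishing linking numbers, so it suffices to
see how the Gauss integral behaves under the operations. It is invariant under little intervals and
additive under concatenation and under composition with embeddings of the tube; a sum of zeros is
zero.

The analytic core is homotopy invariance for long curves, `linkingNumber_eq_of_homotopy`. The Gauss
kernel is a closed 2-form on `ℝ³ \ {0}`, so the divergence theorem on `[0, 1] × [-r, r]²` compares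
the integrals at the two ends of a homotopy. As `r → ∞` the lateral faces disappear: where both
curves are straight the kernel vanishes, because the ends lie in a common plane `re = const`, and
elsewhere it is `O(1 / r²)`. This is why equality of real parts of the end points is assumed
throughout.

Additivity under concatenation (`linkingNumber_superpose`) follows by sliding one piece to infinity.
The linking number is constant along the slide, and in the limit, by dominated convergence, the
integral splits into the two separate ones.

For an embedding `E` of the tube that is `id × φ` near infinity, a pair of curves can be slid along
the tube to where `E` is standard. Its image is then the concatenation of two parallels of `E` and
of an affine copy of the pair, whence `IsTubeMap.linkingNumber_comp`. With the independence of the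
choice of parallels (`FramedLongKnot.linkingNumber_curve_eq`) this makes framing numbers additive
under composition on either side.

For the cores of a string link, knots inserted in the two strands can be straightened
(`linkingNumber_straighten`), and an outer knot contributes its framing number, as its restrictions
to the centres of the two small discs are parallels of it. The concatenation `lambda` is treated by
induction on the number of intervals, splitting off the last one (`linkingNumber_lambda_eq_zero`).
-/

/-- The determinant of three vectors of `ℝ³ = ℝ × ℂ`. -/
def triple (y v w : ℝ × ℂ) : ℝ :=
  y.1 * (v.2.re * w.2.im - v.2.im * w.2.re) - y.2.re * (v.1 * w.2.im - v.2.im * w.1) +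
    y.2.im * (v.1 * w.2.re - v.2.re * w.1)

/-- The squared Euclidean norm on `ℝ³ = ℝ × ℂ`. -/
def sqNorm (y : ℝ × ℂ) : ℝ := y.1 ^ 2 + y.2.re ^ 2 + y.2.im ^ 2

/-- The integrand of Gauss' linking integral. -/
noncomputable def gaussKernel (y v w : ℝ × ℂ) : ℝ := triple y v w / √(sqNorm y) ^ 3

theorem linkingNumber_eq (a b : ℝ → ℝ × ℂ) : linkingNumber a b = 1 / (4 * Real.pi) *
    ∫ p : ℝ × ℝ, gaussKernel (a p.1 - b p.2) (deriv a p.1) (deriv b p.2) := by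
  unfold linkingNumber
  congr 2 with p
  rw [Matrix.det_fin_three]
  simp only [gaussKernel, triple, sqNorm, Matrix.of_apply, Matrix.cons_val', Matrix.cons_val_zero,
    Matrix.cons_val_one, Matrix.cons_val]
  congr 1
  ring

theorem sqNorm_pos {y : ℝ × ℂ} (hy : y ≠ 0) : 0 < sqNorm y := by
  by_contra h
  unfold sqNorm at h
  have h1 : y.1 = 0 := by nlinarith [sq_nonneg y.1, sq_nonneg y.2.re, sq_nonneg y.2.im]
  have h2 : y.2.re = 0 := by nlinarith [sq_nonneg y.1, sq_nonneg y.2.re, sq_nonneg y.2.im]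
  have h3 : y.2.im = 0 := by nlinarith [sq_nonneg y.1, sq_nonneg y.2.re, sq_nonneg y.2.im]
  exact hy (Prod.ext h1 (Complex.ext h2 h3))

/-- The norm of `ℝ × ℂ` is the maximum of the norms of the components, whereas the kernel involves
the Euclidean norm. This one-sided comparison is enough to bound the kernel from above. -/
theorem norm_le_sqrt_sqNorm (y : ℝ × ℂ) : ‖y‖ ≤ √(sqNorm y) := by
  rw [Prod.norm_def]
  refine max_le (Real.abs_le_sqrt ?_) ?_
  · unfold sqNorm
    nlinarith [sq_nonneg y.2.re, sq_nonneg y.2.im]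
  · refine Real.le_sqrt_of_sq_le ?_
    rw [Complex.sq_norm, Complex.normSq_apply]
    unfold sqNorm
    nlinarith [sq_nonneg y.1]

theorem abs_triple_le (y v w : ℝ × ℂ) : |triple y v w| ≤ 6 * (‖y‖ * (‖v‖ * ‖w‖)) := by
  have h1 (x : ℝ × ℂ) : |x.1| ≤ ‖x‖ := norm_fst_le x
  have h2 (x : ℝ × ℂ) : |x.2.re| ≤ ‖x‖ := (Complex.abs_re_le_norm _).trans (norm_snd_le x)
  have h3 (x : ℝ × ℂ) : |x.2.im| ≤ ‖x‖ := (Complex.abs_im_le_norm _).trans (norm_snd_le x)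
  have key {a b c : ℝ} (ha : |a| ≤ ‖y‖) (hb : |b| ≤ ‖v‖) (hc : |c| ≤ ‖w‖) :
      |a * (b * c)| ≤ ‖y‖ * (‖v‖ * ‖w‖) := by
    rw [abs_mul, abs_mul]
    gcongr
  have := abs_le.mp (key (h1 y) (h2 v) (h3 w))
  have := abs_le.mp (key (h1 y) (h3 v) (h2 w))
  have := abs_le.mp (key (h2 y) (h1 v) (h3 w))
  have := abs_le.mp (key (h2 y) (h3 v) (h1 w))
  have := abs_le.mp (key (h3 y) (h1 v) (h2 w))
  have := abs_le.mp (key (h3 y) (h2 v) (h1 w))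
  unfold triple
  rw [abs_le]
  constructor <;> linarith

/-- Inverse-square decay: the numerator is linear in `y` and the denominator cubic. At `y = 0` both
sides are zero by the convention on division by zero. -/
theorem abs_gaussKernel_le (y v w : ℝ × ℂ) :
    |gaussKernel y v w| ≤ 6 * (‖v‖ * ‖w‖) / ‖y‖ ^ 2 := by
  rcases eq_or_ne y 0 with rfl | hy
  · simp [gaussKernel, triple]
  have hn : 0 < ‖y‖ := norm_pos_iff.mpr hy
  rw [gaussKernel, abs_div, abs_of_nonneg (pow_nonneg (Real.sqrt_nonneg _) 3)]
  calc |triple y v w| / √(sqNorm y) ^ 3 ≤ 6 * (‖y‖ * (‖v‖ * ‖w‖)) / ‖y‖ ^ 3 := by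
        gcongr
        · exact abs_triple_le y v w
        · exact norm_le_sqrt_sqNorm y
    _ = 6 * (‖v‖ * ‖w‖) / ‖y‖ ^ 2 := by field_simp

theorem abs_gaussKernel_le_of_le {y v w : ℝ × ℂ} {r c d : ℝ} (hr : 0 < r) (hy : r ≤ ‖y‖)
    (hv : ‖v‖ ≤ c) (hw : ‖w‖ ≤ d) : |gaussKernel y v w| ≤ 6 * (c * d) / r ^ 2 := by
  refine (abs_gaussKernel_le y v w).trans ?_
  have hc : 0 ≤ c := (norm_nonneg v).trans hv
  have hd : 0 ≤ d := (norm_nonneg w).trans hw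
  gcongr

/-- The signs from `y ↦ -y` and from exchanging two arguments of the determinant cancel. This is the
source of the symmetry of the linking number. -/
theorem gaussKernel_swap (y v w : ℝ × ℂ) : gaussKernel (-y) w v = gaussKernel y v w := by
  simp only [gaussKernel, triple, sqNorm, Prod.fst_neg, Prod.snd_neg, Complex.neg_re,
    Complex.neg_im, neg_sq]
  congr 1
  ring

theorem gaussKernel_neg_left (y v w : ℝ × ℂ) : gaussKernel y (-v) w = -gaussKernel y v w := by
  simp only [gaussKernel, triple, Prod.fst_neg, Prod.snd_neg, Complex.neg_re, Complex.neg_im,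
    ← neg_div]
  congr 1
  ring

theorem gaussKernel_neg_neg (y v w : ℝ × ℂ) : gaussKernel (-y) (-v) w = gaussKernel y v w := by
  rw [gaussKernel_neg_left, ← gaussKernel_swap, neg_neg]
  simp only [gaussKernel, triple, ← neg_div]
  congr 1
  ring

/-- Three coplanar vectors have zero determinant. This kills the kernel on the lateral faces
wherever both curves of a homotopy are on their lines. -/
theorem gaussKernel_of_re_eq_zero {y v w : ℝ × ℂ} (hy : y.2.re = 0) (hv : v.2.re = 0)
    (hw : w.2.re = 0) : gaussKernel y v w = 0 := by
  simp [gaussKernel, triple, hy, hv, hw]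

theorem gaussKernel_self (y v : ℝ × ℂ) : gaussKernel y v v = 0 := by
  simp only [gaussKernel, triple]
  ring

theorem contDiff_triple : ContDiff ℝ ∞ fun q : (ℝ × ℂ) × (ℝ × ℂ) × (ℝ × ℂ) =>
    triple q.1 q.2.1 q.2.2 := by
  have hre : ContDiff ℝ ∞ Complex.re := Complex.reCLM.contDiff
  have him : ContDiff ℝ ∞ Complex.im := Complex.imCLM.contDiff
  unfold triple
  fun_prop

theorem contDiff_sqNorm : ContDiff ℝ ∞ sqNorm := by
  have hre : ContDiff ℝ ∞ Complex.re := Complex.reCLM.contDiff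
  have him : ContDiff ℝ ∞ Complex.im := Complex.imCLM.contDiff
  unfold sqNorm
  fun_prop

theorem contDiffAt_gaussKernel {E : Type*} [NormedAddCommGroup E] [NormedSpace ℝ E]
    {y v w : E → ℝ × ℂ} {x : E} (hy : ContDiffAt ℝ ∞ y x) (hv : ContDiffAt ℝ ∞ v x)
    (hw : ContDiffAt ℝ ∞ w x) (h0 : y x ≠ 0) :
    ContDiffAt ℝ ∞ (fun x => gaussKernel (y x) (v x) (w x)) x := by
  unfold gaussKernel
  have h1 : ContDiffAt ℝ ∞ (fun x => triple (y x) (v x) (w x)) x :=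
    contDiff_triple.contDiffAt.comp x (hy.prodMk (hv.prodMk hw))
  have h2 : ContDiffAt ℝ ∞ (fun x => √(sqNorm (y x))) x :=
    (contDiff_sqNorm.contDiffAt.comp x hy).sqrt (sqNorm_pos h0).ne'
  exact h1.div (h2.pow 3) (pow_pos (Real.sqrt_pos.mpr (sqNorm_pos h0)) 3).ne'

/-- The derivative of the Gauss kernel along a curve. -/
theorem hasDerivAt_gaussKernel {y v w : ℝ → ℝ × ℂ} {y' v' w' : ℝ × ℂ} {r : ℝ}
    (hy : HasDerivAt y y' r) (hv : HasDerivAt v v' r) (hw : HasDerivAt w w' r) (h0 : y r ≠ 0) :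
    HasDerivAt (fun r => gaussKernel (y r) (v r) (w r))
      ((triple y' (v r) (w r) + triple (y r) v' (w r) + triple (y r) (v r) w') /
          √(sqNorm (y r)) ^ 3 -
        3 * triple (y r) (v r) (w r) *
          ((y r).1 * y'.1 + (y r).2.re * y'.2.re + (y r).2.im * y'.2.im) /
            √(sqNorm (y r)) ^ 5) r := by
  have fst {a : ℝ → ℝ × ℂ} {a' : ℝ × ℂ} (h : HasDerivAt a a' r) :
      HasDerivAt (fun r => (a r).1) a'.1 r := h.fst
  have re {a : ℝ → ℝ × ℂ} {a' : ℝ × ℂ} (h : HasDerivAt a a' r) :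
      HasDerivAt (fun r => (a r).2.re) a'.2.re r :=
    Complex.reCLM.hasFDerivAt.comp_hasDerivAt r h.snd
  have im {a : ℝ → ℝ × ℂ} {a' : ℝ × ℂ} (h : HasDerivAt a a' r) :
      HasDerivAt (fun r => (a r).2.im) a'.2.im r :=
    Complex.imCLM.hasFDerivAt.comp_hasDerivAt r h.snd
  have hN : HasDerivAt (fun r => triple (y r) (v r) (w r))
      (triple y' (v r) (w r) + triple (y r) v' (w r) + triple (y r) (v r) w') r := by
    unfold triple
    refine HasDerivAt.congr_deriv
      ((((fst hy).mul (((re hv).mul (im hw)).sub ((im hv).mul (re hw)))).sub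
      ((re hy).mul (((fst hv).mul (im hw)).sub ((im hv).mul (fst hw))))).add
      ((im hy).mul (((fst hv).mul (re hw)).sub ((re hv).mul (fst hw))))) ?_
    simp only [Pi.sub_apply, Pi.mul_apply]
    ring
  have hQ : HasDerivAt (fun r => sqNorm (y r))
      (2 * ((y r).1 * y'.1 + (y r).2.re * y'.2.re + (y r).2.im * y'.2.im)) r := by
    unfold sqNorm
    refine HasDerivAt.congr_deriv ((((fst hy).pow 2).add ((re hy).pow 2)).add ((im hy).pow 2)) ?_
    push_cast
    ring
  have hρ := Real.sqrt_pos.mpr (sqNorm_pos h0)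
  have hD := hN.div ((hQ.sqrt (sqNorm_pos h0).ne').pow 3) (pow_pos hρ 3).ne'
  refine hD.congr_deriv ?_
  simp only [Pi.pow_apply]
  field_simp
  ring

/-- The Gauss kernel, as a `2`-form, is closed. -/
theorem gaussKernel_closed (y p a b α β : ℝ × ℂ) (h0 : y ≠ 0) :
    ((triple p a b + triple y α b + triple y a β) / √(sqNorm y) ^ 3 -
        3 * triple y a b * (y.1 * p.1 + y.2.re * p.2.re + y.2.im * p.2.im) / √(sqNorm y) ^ 5) +
      -((triple a p b + triple y α b + triple y p 0) / √(sqNorm y) ^ 3 -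
        3 * triple y p b * (y.1 * a.1 + y.2.re * a.2.re + y.2.im * a.2.im) / √(sqNorm y) ^ 5) +
      -((triple (-b) p a + triple y (-β) a + triple y p 0) / √(sqNorm y) ^ 3 -
        3 * triple y p a * (y.1 * (-b).1 + y.2.re * (-b).2.re + y.2.im * (-b).2.im) /
          √(sqNorm y) ^ 5) = 0 := by
  have hρ := Real.sqrt_pos.mpr (sqNorm_pos h0)
  have hQ : √(sqNorm y) ^ 2 = sqNorm y := Real.sq_sqrt (sqNorm_pos h0).le
  -- In the application `y = A - B`, `p` is its derivative in the homotopy parameter, `a` and `b`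
  -- are the velocities of the two curves, and `α`, `β` are mixed second derivatives. Over the
  -- common denominator `√(sqNorm y) ^ 5` the claim becomes a polynomial identity, which amounts to
  -- `y / |y|³` having zero divergence.
  have e (c d : ℝ) : c / √(sqNorm y) ^ 3 - d / √(sqNorm y) ^ 5 =
      (c * sqNorm y - d) / √(sqNorm y) ^ 5 := by
    calc c / √(sqNorm y) ^ 3 - d / √(sqNorm y) ^ 5 =
        (c * √(sqNorm y) ^ 2 - d) / √(sqNorm y) ^ 5 := by field_simp
      _ = _ := by rw [hQ]
  rw [e, e, e, ← neg_div, ← neg_div, ← add_div, ← add_div]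
  refine div_eq_zero_iff.mpr (Or.inl ?_)
  simp only [triple, sqNorm, Prod.fst_neg, Prod.snd_neg, Complex.neg_re, Complex.neg_im,
    Prod.fst_zero, Prod.snd_zero, Complex.zero_re, Complex.zero_im]
  ring

/-! ## The divergence theorem on a box -/

/-- The divergence theorem with the six faces spelled out. Coordinate `0` is the homotopy parameter,
and the other two are the parameters of the curves. -/
theorem sum_faces_eq_zero {R : ℝ} (hR : 0 ≤ R) (f : Fin 3 → (Fin 3 → ℝ) → ℝ)
    (hf : ∀ x ∈ Icc (![0, -R, -R] : Fin 3 → ℝ) ![1, R, R], ∀ i, DifferentiableAt ℝ (f i) x)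
    (hdiv : ∀ x ∈ Icc (![0, -R, -R] : Fin 3 → ℝ) ![1, R, R],
      ∑ i, fderiv ℝ (f i) x (Pi.single i 1) = 0) :
    ((∫ x in Icc (![-R, -R] : Fin 2 → ℝ) ![R, R], f 0 ![1, x 0, x 1]) -
        ∫ x in Icc (![-R, -R] : Fin 2 → ℝ) ![R, R], f 0 ![0, x 0, x 1]) +
      ((∫ x in Icc (![0, -R] : Fin 2 → ℝ) ![1, R], f 1 ![x 0, R, x 1]) -
        ∫ x in Icc (![0, -R] : Fin 2 → ℝ) ![1, R], f 1 ![x 0, -R, x 1]) +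
      ((∫ x in Icc (![0, -R] : Fin 2 → ℝ) ![1, R], f 2 ![x 0, x 1, R]) -
        ∫ x in Icc (![0, -R] : Fin 2 → ℝ) ![1, R], f 2 ![x 0, x 1, -R]) = 0 := by
  have hle : (![0, -R, -R] : Fin 3 → ℝ) ≤ ![1, R, R] := by
    intro i
    fin_cases i <;> simp [hR]
  have h0 : IntegrableOn (fun x => ∑ i, fderiv ℝ (f i) x (Pi.single i 1))
      (Icc (![0, -R, -R] : Fin 3 → ℝ) ![1, R, R]) :=
    integrableOn_zero.congr_fun (fun x hx => (hdiv x hx).symm) measurableSet_Icc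
  have key := integral_divergence_of_hasFDerivAt_off_countable' ![0, -R, -R] ![1, R, R] hle f
    (fun i x => fderiv ℝ (f i) x) ∅ countable_empty
    (fun i x hx => (hf x hx i).continuousAt.continuousWithinAt)
    (fun x hx i => (hf x ⟨fun j => (hx.1 j (mem_univ j)).1.le,
      fun j => (hx.1 j (mem_univ j)).2.le⟩ i).hasFDerivAt) h0
  rw [setIntegral_congr_fun measurableSet_Icc hdiv, integral_zero, Fin.sum_univ_three] at key
  have c0 (a b c : ℝ) : (![a, b, c] : Fin 3 → ℝ) ∘ Fin.succAbove 0 = ![b, c] := by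
    ext i; fin_cases i <;> rfl
  have c1 (a b c : ℝ) : (![a, b, c] : Fin 3 → ℝ) ∘ Fin.succAbove 1 = ![a, c] := by
    ext i; fin_cases i <;> rfl
  have c2 (a b c : ℝ) : (![a, b, c] : Fin 3 → ℝ) ∘ Fin.succAbove 2 = ![a, b] := by
    ext i; fin_cases i <;> rfl
  have d0 (a : ℝ) (x : Fin 2 → ℝ) :
      (Fin.insertNth 0 a x : Fin 3 → ℝ) = ![a, x 0, x 1] := by
    ext i; fin_cases i <;> rfl
  have d1 (a : ℝ) (x : Fin 2 → ℝ) :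
      (Fin.insertNth 1 a x : Fin 3 → ℝ) = ![x 0, a, x 1] := by
    ext i; fin_cases i <;> rfl
  have d2 (a : ℝ) (x : Fin 2 → ℝ) :
      (Fin.insertNth 2 a x : Fin 3 → ℝ) = ![x 0, x 1, a] := by
    ext i; fin_cases i <;> rfl
  simp only [c0, c1, c2, d0, d1, d2, Matrix.cons_val_zero, Matrix.cons_val_one, Matrix.cons_val]
    at key
  exact key.symm

/-! ## Long curves -/

/-- The curve `a` is smooth and agrees with the line `ℝ × {z}` outside of `(-R, R)`. -/
structure IsLong (a : ℝ → ℝ × ℂ) (R : ℝ) (z : ℂ) : Prop where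
  contDiff : ContDiff ℝ ∞ a
  eq_line : ∀ s, R ≤ |s| → a s = (s, z)

theorem IsLong.mono {a : ℝ → ℝ × ℂ} {R R' : ℝ} {z : ℂ} (ha : IsLong a R z) (h : R ≤ R') :
    IsLong a R' z := ⟨ha.contDiff, fun s hs => ha.eq_line s (h.trans hs)⟩

theorem hasDerivAt_line (z : ℂ) (s : ℝ) : HasDerivAt (fun s : ℝ => (s, z)) ((1, 0) : ℝ × ℂ) s :=
  (hasDerivAt_id s).prodMk (hasDerivAt_const s z)

theorem contDiff_line (z : ℂ) : ContDiff ℝ ∞ fun s : ℝ => (s, z) :=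
  contDiff_id.prodMk contDiff_const

theorem eventually_lt_abs {R s : ℝ} (hs : R < |s|) : ∀ᶠ r in 𝓝 s, R < |r| :=
  continuous_abs.continuousAt.eventually_const_lt hs

theorem IsLong.deriv_eq {a : ℝ → ℝ × ℂ} {R : ℝ} {z : ℂ} (ha : IsLong a R z) {s : ℝ}
    (hs : R < |s|) : deriv a s = (1, 0) := by
  have h : a =ᶠ[𝓝 s] fun s => (s, z) :=
    (eventually_lt_abs hs).mono fun r hr => ha.eq_line r hr.le
  rw [h.deriv_eq]
  exact (hasDerivAt_line z s).deriv

theorem IsLong.continuous_deriv {a : ℝ → ℝ × ℂ} {R : ℝ} {z : ℂ} (ha : IsLong a R z) :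
    Continuous (deriv a) := ha.contDiff.continuous_deriv (by simp)

theorem IsLong.hasDerivAt {a : ℝ → ℝ × ℂ} {R : ℝ} {z : ℂ} (ha : IsLong a R z) (s : ℝ) :
    HasDerivAt a (deriv a s) s := (ha.contDiff.differentiable (by simp) s).hasDerivAt

theorem exists_bound_of_eq_const_outside {E : Type*} [NormedAddCommGroup E] {f : ℝ → E}
    (hf : Continuous f) {R : ℝ} {c : E} (h : ∀ s, R < |s| → f s = c) :
    ∃ C, 0 ≤ C ∧ ∀ s, ‖f s‖ ≤ C := by
  obtain ⟨C, hC⟩ := (isCompact_Icc (a := -R) (b := R)).exists_bound_of_continuousOn hf.continuousOn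
  refine ⟨max C ‖c‖, (norm_nonneg c).trans (le_max_right _ _), fun s => ?_⟩
  by_cases hs : |s| ≤ R
  · exact (hC s (abs_le.mp hs)).trans (le_max_left _ _)
  · rw [h s (not_le.mp hs)]
    exact le_max_right _ _

theorem IsLong.exists_bound_deriv {a : ℝ → ℝ × ℂ} {R : ℝ} {z : ℂ} (ha : IsLong a R z) :
    ∃ C, 0 ≤ C ∧ ∀ s, ‖deriv a s‖ ≤ C :=
  exists_bound_of_eq_const_outside ha.continuous_deriv fun _ hs => ha.deriv_eq hs

/-- The first coordinate of a long curve is its parameter up to a bounded error. Hence points with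
distant parameters are distant in space, which is what the inverse-square bound needs. -/
theorem IsLong.exists_bound_fst {a : ℝ → ℝ × ℂ} {R : ℝ} {z : ℂ} (ha : IsLong a R z) :
    ∃ C, 0 ≤ C ∧ ∀ s, |(a s).1 - s| ≤ C :=
  exists_bound_of_eq_const_outside (f := fun s => (a s).1 - s) (R := R) (c := 0)
    ((continuous_fst.comp ha.contDiff.continuous).sub continuous_id)
    fun s hs => by simp [ha.eq_line s hs.le]

/-! ## Integrability of the Gauss integrand -/

/-- The integrand of the linking number of `a` and `b`. -/
noncomputable def linkingIntegrand (a b : ℝ → ℝ × ℂ) (p : ℝ × ℝ) : ℝ :=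
  gaussKernel (a p.1 - b p.2) (deriv a p.1) (deriv b p.2)

theorem linkingNumber_eq_integral (a b : ℝ → ℝ × ℂ) :
    linkingNumber a b = 1 / (4 * Real.pi) * ∫ p, linkingIntegrand a b p := linkingNumber_eq a b

theorem linkingIntegrand_swap (a b : ℝ → ℝ × ℂ) (p : ℝ × ℝ) :
    linkingIntegrand a b p.swap = linkingIntegrand b a p := by
  simp only [linkingIntegrand, Prod.fst_swap, Prod.snd_swap]
  rw [← gaussKernel_swap, neg_sub]

theorem linkingNumber_swap (a b : ℝ → ℝ × ℂ) : linkingNumber a b = linkingNumber b a := by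
  rw [linkingNumber_eq_integral, linkingNumber_eq_integral]
  congr 1
  simp only [← linkingIntegrand_swap a b]
  exact (integral_prod_swap (μ := volume) (ν := volume) (linkingIntegrand a b)).symm

/-- Both velocities are `(1, 0)` there, so the determinant has two equal rows. The integrand is thus
supported in two strips around the axes. -/
theorem IsLong.linkingIntegrand_eq_zero {a b : ℝ → ℝ × ℂ} {R : ℝ} {z w : ℂ} (ha : IsLong a R z)
    (hb : IsLong b R w) {p : ℝ × ℝ} (h1 : R < |p.1|) (h2 : R < |p.2|) :
    linkingIntegrand a b p = 0 := by
  rw [linkingIntegrand, ha.deriv_eq h1, hb.deriv_eq h2, gaussKernel_self]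

theorem contDiff_deriv {a : ℝ → ℝ × ℂ} (ha : ContDiff ℝ ∞ a) : ContDiff ℝ ∞ (deriv a) :=
  (contDiff_infty_iff_deriv.mp ha).2

theorem continuous_linkingIntegrand {a b : ℝ → ℝ × ℂ} (ha : ContDiff ℝ ∞ a) (hb : ContDiff ℝ ∞ b)
    (hab : ∀ s t, a s ≠ b t) : Continuous (linkingIntegrand a b) := by
  refine continuous_iff_continuousAt.mpr fun p => ContDiffAt.continuousAt (𝕜 := ℝ) (n := ∞) ?_
  exact contDiffAt_gaussKernel
    ((ha.comp contDiff_fst).sub (hb.comp contDiff_snd)).contDiffAt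
    ((contDiff_deriv ha).comp contDiff_fst).contDiffAt
    ((contDiff_deriv hb).comp contDiff_snd).contDiffAt (sub_ne_zero.mpr (hab _ _))

theorem abs_gaussKernel_le_of_half_le {y v w : ℝ × ℂ} {t c d : ℝ} (ht : 1 ≤ |t|)
    (hy : |t| / 2 ≤ ‖y‖) (hv : ‖v‖ ≤ c) (hw : ‖w‖ ≤ d) :
    |gaussKernel y v w| ≤ 48 * (c * d) * (1 + t ^ 2)⁻¹ := by
  have hc : 0 ≤ c := (norm_nonneg v).trans hv
  have hd : 0 ≤ d := (norm_nonneg w).trans hw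
  -- The bound is `6 c d / (|t| / 2)² = 24 c d / t²`, and `1 + t² ≤ 2 t²` since `|t| ≥ 1`; this
  -- gives the constant `48`.
  refine (abs_gaussKernel_le_of_le (by linarith) hy hv hw).trans ?_
  have h1 : 1 ≤ t ^ 2 := by
    rw [← sq_abs]
    nlinarith
  rw [← div_eq_mul_inv, div_pow, sq_abs, div_le_div_iff₀ (by positivity) (by positivity)]
  nlinarith [mul_nonneg hc hd]

/-- The integrand decays quadratically in a strip. -/
theorem IsLong.exists_bound_strip {a b : ℝ → ℝ × ℂ} {R : ℝ} {z w : ℂ} (ha : IsLong a R z)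
    (hb : IsLong b R w) (hab : ∀ s t, a s ≠ b t) (S : ℝ) :
    ∃ C, ∀ s t, |s| ≤ S → |linkingIntegrand a b (s, t)| ≤ C * (1 + t ^ 2)⁻¹ := by
  obtain ⟨ca, hca0, hca⟩ := ha.exists_bound_deriv
  obtain ⟨cb, hcb0, hcb⟩ := hb.exists_bound_deriv
  obtain ⟨da, hda0, hda⟩ := ha.exists_bound_fst
  obtain ⟨db, hdb0, hdb⟩ := hb.exists_bound_fst
  -- For `|s| ≤ S` the first coordinates of `a s` and `b t` differ by at least `|t| - (da + db +
  -- |S|)`. With this `M`, `|t| > M` makes the difference at least `|t| / 2` and ensures `|t| ≥ 1`.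
  -- Compactness handles `|t| ≤ M`.
  set M := 2 * (da + db + |S|) + 1
  obtain ⟨C, hC⟩ := (isCompact_Icc (a := -S) (b := S)).prod (isCompact_Icc (a := -M) (b := M))
    |>.exists_bound_of_continuousOn
      (continuous_linkingIntegrand ha.contDiff hb.contDiff hab).continuousOn
  refine ⟨max (C * (1 + M ^ 2)) (48 * (ca * cb)), fun s t hs => ?_⟩
  have hpos : 0 < (1 + t ^ 2)⁻¹ := by positivity
  by_cases ht : |t| ≤ M
  · have h1 : |linkingIntegrand a b (s, t)| ≤ C := hC (s, t) ⟨abs_le.mp hs, abs_le.mp ht⟩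
    have hC0 : 0 ≤ C := (abs_nonneg _).trans h1
    have h2 : t ^ 2 ≤ M ^ 2 := sq_le_sq' (abs_le.mp ht).1 (abs_le.mp ht).2
    refine h1.trans (le_trans ?_ (mul_le_mul_of_nonneg_right (le_max_left _ _) hpos.le))
    rw [← div_eq_mul_inv, le_div_iff₀ (by positivity)]
    gcongr
  · push Not at ht
    have hS : |S| ≥ 0 := abs_nonneg S
    have h1 : |t| / 2 ≤ ‖a s - b t‖ := by
      refine le_trans ?_ (norm_fst_le _)
      have e1 := abs_le.mp (hda s)
      have e2 := abs_le.mp (hdb t)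
      have e3 := abs_le.mp (hs.trans (le_abs_self S))
      rw [Real.norm_eq_abs, Prod.fst_sub, le_abs]
      rcases abs_cases t with ⟨h, h'⟩ | ⟨h, h'⟩ <;> rw [h] at ht ⊢
      · right; linarith
      · left; linarith
    exact (abs_gaussKernel_le_of_half_le (by linarith) h1 (hca s) (hcb t)).trans
      (mul_le_mul_of_nonneg_right (le_max_right _ _) hpos.le)

/-- The function that is `1` on `[-S, S]` and `0` elsewhere. -/
noncomputable def bump (S : ℝ) : ℝ → ℝ := (Icc (-S) S).indicator fun _ => 1

theorem bump_of_le {S s : ℝ} (h : |s| ≤ S) : bump S s = 1 :=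
  indicator_of_mem (s := Icc (-S) S) (abs_le.mp h) _

theorem bump_nonneg (S s : ℝ) : 0 ≤ bump S s := indicator_nonneg (fun _ _ => zero_le_one) s

theorem integrable_bump_mul (S : ℝ) :
    Integrable fun p : ℝ × ℝ => bump S p.1 * (1 + p.2 ^ 2)⁻¹ := by
  have h : Integrable (bump S) :=
    (integrable_indicator_iff measurableSet_Icc).mpr (integrableOn_const (by simp))
  exact h.mul_prod integrable_inv_one_add_sq

theorem integrable_bump_mul' (S : ℝ) :
    Integrable fun p : ℝ × ℝ => bump S p.2 * (1 + p.1 ^ 2)⁻¹ :=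
  (integrable_bump_mul S).swap

/-- The union of the strips of half-width `S` around the coordinate axes. -/
def cross (S : ℝ) : Set (ℝ × ℝ) := {p | |p.1| ≤ S ∨ |p.2| ≤ S}

theorem measurableSet_cross (S : ℝ) : MeasurableSet (cross S) :=
  ((isClosed_le (continuous_abs.comp continuous_fst) continuous_const).union
    (isClosed_le (continuous_abs.comp continuous_snd) continuous_const)).measurableSet

theorem notMem_cross {S : ℝ} {p : ℝ × ℝ} : p ∉ cross S ↔ S < |p.1| ∧ S < |p.2| := by
  simp [cross, not_or]

/-- An integrable function that dominates on the cross the functions with quadratic decay along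
the two strips. -/
noncomputable def crossBound (C D S : ℝ) (p : ℝ × ℝ) : ℝ :=
  |C| * (bump S p.1 * (1 + p.2 ^ 2)⁻¹) + |D| * (bump S p.2 * (1 + p.1 ^ 2)⁻¹)

theorem integrable_crossBound (C D S : ℝ) : Integrable (crossBound C D S) :=
  ((integrable_bump_mul S).const_mul |C|).add ((integrable_bump_mul' S).const_mul |D|)

theorem crossBound_nonneg (C D S : ℝ) (p : ℝ × ℝ) : 0 ≤ crossBound C D S p :=
  add_nonneg (mul_nonneg (abs_nonneg _) (mul_nonneg (bump_nonneg _ _) (by positivity)))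
    (mul_nonneg (abs_nonneg _) (mul_nonneg (bump_nonneg _ _) (by positivity)))

theorem le_crossBound {C D S : ℝ} {p : ℝ × ℝ} {x : ℝ}
    (h1 : |p.1| ≤ S → x ≤ C * (1 + p.2 ^ 2)⁻¹) (h2 : |p.2| ≤ S → x ≤ D * (1 + p.1 ^ 2)⁻¹)
    (hp : p ∈ cross S) : x ≤ crossBound C D S p := by
  unfold crossBound
  rcases hp with hp | hp
  · refine (h1 hp).trans (le_add_of_le_of_nonneg ?_
      (mul_nonneg (abs_nonneg _) (mul_nonneg (bump_nonneg _ _) (by positivity))))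
    rw [bump_of_le hp, one_mul]
    exact mul_le_mul_of_nonneg_right (le_abs_self C) (by positivity)
  · refine (h2 hp).trans (le_add_of_nonneg_of_le
      (mul_nonneg (abs_nonneg _) (mul_nonneg (bump_nonneg _ _) (by positivity))) ?_)
    rw [bump_of_le hp, one_mul]
    exact mul_le_mul_of_nonneg_right (le_abs_self D) (by positivity)

/-- The integrand vanishes off the cross, and in each of its two strips it decays quadratically in
the unbounded variable; the second strip is the first one with the curves exchanged. -/
theorem IsLong.integrable {a b : ℝ → ℝ × ℂ} {R : ℝ} {z w : ℂ} (ha : IsLong a R z)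
    (hb : IsLong b R w) (hab : ∀ s t, a s ≠ b t) : Integrable (linkingIntegrand a b) := by
  obtain ⟨C, hC⟩ := ha.exists_bound_strip hb hab R
  obtain ⟨D, hD⟩ := hb.exists_bound_strip ha (fun s t => (hab t s).symm) R
  refine (integrable_crossBound C D R).mono'
    (continuous_linkingIntegrand ha.contDiff hb.contDiff hab).aestronglyMeasurable
    (.of_forall fun p => ?_)
  by_cases hp : p ∈ cross R
  · refine le_crossBound (hC p.1 p.2) (fun ht => ?_) hp
    rw [← linkingIntegrand_swap]
    exact hD p.2 p.1 ht
  · obtain ⟨h1, h2⟩ := notMem_cross.mp hp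
    rw [ha.linkingIntegrand_eq_zero hb h1 h2, norm_zero]
    exact crossBound_nonneg C D R p

/-! ## Homotopy invariance -/

/-- The derivative with respect to the parameter of the homotopy. -/
noncomputable def derivFst (A : ℝ × ℝ → ℝ × ℂ) (p : ℝ × ℝ) : ℝ × ℂ := fderiv ℝ A p (1, 0)

/-- The derivative with respect to the parameter of the curve. -/
noncomputable def derivSnd (A : ℝ × ℝ → ℝ × ℂ) (p : ℝ × ℝ) : ℝ × ℂ := fderiv ℝ A p (0, 1)

theorem contDiff_derivFst {A : ℝ × ℝ → ℝ × ℂ} (hA : ContDiff ℝ ∞ A) : ContDiff ℝ ∞ (derivFst A) :=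
  (hA.fderiv_right (m := ∞) (by simp)).clm_apply contDiff_const

theorem contDiff_derivSnd {A : ℝ × ℝ → ℝ × ℂ} (hA : ContDiff ℝ ∞ A) : ContDiff ℝ ∞ (derivSnd A) :=
  (hA.fderiv_right (m := ∞) (by simp)).clm_apply contDiff_const

theorem hasDerivAt_derivFst {A : ℝ × ℝ → ℝ × ℂ} (hA : ContDiff ℝ ∞ A) (u s : ℝ) :
    HasDerivAt (fun r => A (r, s)) (derivFst A (u, s)) u :=
  HasFDerivAt.comp_hasDerivAt u (hA.differentiable (by simp) (u, s)).hasFDerivAt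
    ((hasDerivAt_id u).prodMk (hasDerivAt_const u s))

theorem hasDerivAt_derivSnd {A : ℝ × ℝ → ℝ × ℂ} (hA : ContDiff ℝ ∞ A) (u s : ℝ) :
    HasDerivAt (fun r => A (u, r)) (derivSnd A (u, s)) s :=
  HasFDerivAt.comp_hasDerivAt s (hA.differentiable (by simp) (u, s)).hasFDerivAt
    ((hasDerivAt_const s u).prodMk (hasDerivAt_id s))

theorem derivSnd_derivFst {A : ℝ × ℝ → ℝ × ℂ} (hA : ContDiff ℝ ∞ A) (p : ℝ × ℝ) :
    derivSnd (derivFst A) p = derivFst (derivSnd A) p := by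
  have hd : DifferentiableAt ℝ (fderiv ℝ A) p :=
    (hA.fderiv_right (m := ∞) (by simp)).differentiable (by simp) p
  have h : IsSymmSndFDerivAt ℝ A p := hA.contDiffAt.isSymmSndFDerivAt (by
    rw [minSmoothness_of_isRCLikeNormedField]
    exact (mod_cast le_top : ((2 : ℕ∞) : WithTop ℕ∞) ≤ ∞))
  have e (v : ℝ × ℝ) : HasFDerivAt (fun q => fderiv ℝ A q v)
      ((ContinuousLinearMap.apply ℝ (ℝ × ℂ) v).comp (fderiv ℝ (fderiv ℝ A) p)) p :=
    (ContinuousLinearMap.apply ℝ (ℝ × ℂ) v).hasFDerivAt.comp p hd.hasFDerivAt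
  unfold derivSnd derivFst
  rw [(e _).fderiv, (e _).fderiv]
  exact h _ _

/-- A smooth family of curves, the `u`-th of which agrees with the line `ℝ × {z u}` outside of
`(-R, R)`, for `0 ≤ u ≤ 1`. -/
structure IsLongFamily (A : ℝ × ℝ → ℝ × ℂ) (R : ℝ) (z : ℝ → ℂ) : Prop where
  contDiff : ContDiff ℝ ∞ A
  eq_line : ∀ u ∈ Icc (0 : ℝ) 1, ∀ s, R ≤ |s| → A (u, s) = (s, z u)

theorem IsLongFamily.isLong {A : ℝ × ℝ → ℝ × ℂ} {R : ℝ} {z : ℝ → ℂ} (hA : IsLongFamily A R z)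
    {u : ℝ} (hu : u ∈ Icc (0 : ℝ) 1) : IsLong (fun s => A (u, s)) R (z u) :=
  ⟨hA.contDiff.comp (contDiff_const.prodMk contDiff_id), hA.eq_line u hu⟩

/-- A family is controlled only for parameters in `[0, 1]`, so at the two end points derivatives
have to be compared from one side. -/
theorem HasDerivAt.unique_of_eqOn_Icc {E : Type*} [NormedAddCommGroup E] [NormedSpace ℝ E]
    {f g : ℝ → E} {f' g' : E} {u : ℝ} (hu : u ∈ Icc (0 : ℝ) 1) (hf : HasDerivAt f f' u)
    (hg : HasDerivAt g g' u) (h : EqOn f g (Icc 0 1)) : f' = g' :=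
  (uniqueDiffOn_Icc zero_lt_one u hu).eq_deriv _ (hf.hasDerivWithinAt.congr (fun _ hx => (h hx).symm)
    (h hu).symm) hg.hasDerivWithinAt

/-- The function `z` need not be differentiable. Instead, two straight positions of the family
differ by a vector independent of the homotopy parameter, so their derivatives agree. -/
theorem IsLongFamily.derivFst_eq {A : ℝ × ℝ → ℝ × ℂ} {R : ℝ} {z : ℝ → ℂ} (hA : IsLongFamily A R z)
    {u : ℝ} (hu : u ∈ Icc (0 : ℝ) 1) {s t : ℝ} (hs : R ≤ |s|) (ht : R ≤ |t|) :
    derivFst A (u, s) = derivFst A (u, t) := by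
  refine HasDerivAt.unique_of_eqOn_Icc (g := fun r => A (r, t) + (s - t, 0)) hu
    (hasDerivAt_derivFst hA.contDiff u s)
    ((hasDerivAt_derivFst hA.contDiff u t).add_const _) fun v hv => ?_
  simp [hA.eq_line v hv s hs, hA.eq_line v hv t ht]

/-- The vector field with vanishing divergence given by the pull-back of the Gauss kernel under
`(u, s, t) ↦ A (u, s) - B (u, t)`. -/
noncomputable def gaussField (A B : ℝ × ℝ → ℝ × ℂ) : Fin 3 → (Fin 3 → ℝ) → ℝ :=
  ![fun x => gaussKernel (A (x 0, x 1) - B (x 0, x 2)) (derivSnd A (x 0, x 1))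
      (derivSnd B (x 0, x 2)),
    fun x => -gaussKernel (A (x 0, x 1) - B (x 0, x 2))
      (derivFst A (x 0, x 1) - derivFst B (x 0, x 2)) (derivSnd B (x 0, x 2)),
    fun x => -gaussKernel (A (x 0, x 1) - B (x 0, x 2))
      (derivFst A (x 0, x 1) - derivFst B (x 0, x 2)) (derivSnd A (x 0, x 1))]

theorem differentiableAt_gaussField {A B : ℝ × ℝ → ℝ × ℂ} (hA : ContDiff ℝ ∞ A)
    (hB : ContDiff ℝ ∞ B) {x : Fin 3 → ℝ} (h0 : A (x 0, x 1) ≠ B (x 0, x 2)) (i : Fin 3) :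
    DifferentiableAt ℝ (gaussField A B i) x := by
  have h1 : ContDiff ℝ ∞ fun x : Fin 3 → ℝ => (x 0, x 1) :=
    (contDiff_apply ℝ ℝ 0).prodMk (contDiff_apply ℝ ℝ 1)
  have h2 : ContDiff ℝ ∞ fun x : Fin 3 → ℝ => (x 0, x 2) :=
    (contDiff_apply ℝ ℝ 0).prodMk (contDiff_apply ℝ ℝ 2)
  have hy := ((hA.comp h1).sub (hB.comp h2)).contDiffAt (x := x)
  have hu := (((contDiff_derivFst hA).comp h1).sub
    ((contDiff_derivFst hB).comp h2)).contDiffAt (x := x)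
  have ha := ((contDiff_derivSnd hA).comp h1).contDiffAt (x := x)
  have hb := ((contDiff_derivSnd hB).comp h2).contDiffAt (x := x)
  have h0' := sub_ne_zero.mpr h0
  fin_cases i
  · exact (contDiffAt_gaussKernel hy ha hb h0').differentiableAt (by simp)
  · exact (contDiffAt_gaussKernel hy hu hb h0').differentiableAt (by simp) |>.neg
  · exact (contDiffAt_gaussKernel hy hu ha h0').differentiableAt (by simp) |>.neg

theorem fderiv_single_eq {n : ℕ} {f : (Fin n → ℝ) → ℝ} {x : Fin n → ℝ} (hf : DifferentiableAt ℝ f x)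
    {i : Fin n} {d : ℝ} (h : HasDerivAt (fun r => f (Function.update x i r)) d (x i)) :
    fderiv ℝ f x (Pi.single i 1) = d := by
  have h1 : HasDerivAt (Function.update x i) (Pi.single i 1) (x i) := hasDerivAt_update x i (x i)
  have h2 : HasFDerivAt f (fderiv ℝ f x) (Function.update x i (x i)) := by
    rw [Function.update_eq_self]
    exact hf.hasFDerivAt
  exact (h2.comp_hasDerivAt _ h1).unique h

/-- The pull-back of a closed form is closed. In coordinates the three partial derivatives are the
three groups of terms of `gaussKernel_closed`, once the mixed second derivatives of `A` and of `B`
are identified by symmetry. -/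
theorem div_gaussField {A B : ℝ × ℝ → ℝ × ℂ} (hA : ContDiff ℝ ∞ A)
    (hB : ContDiff ℝ ∞ B) {x : Fin 3 → ℝ} (h0 : A (x 0, x 1) ≠ B (x 0, x 2)) :
    ∑ i, fderiv ℝ (gaussField A B i) x (Pi.single i 1) = 0 := by
  have h0' := sub_ne_zero.mpr h0
  have hd := differentiableAt_gaussField hA hB h0
  have hA' := contDiff_derivSnd hA
  have hB' := contDiff_derivSnd hB
  have e0 := fderiv_single_eq (i := 0) (hd 0)
    (hasDerivAt_gaussKernel (r := x 0) ((hasDerivAt_derivFst hA (x 0) (x 1)).sub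
      (hasDerivAt_derivFst hB (x 0) (x 2))) (hasDerivAt_derivFst hA' (x 0) (x 1))
      (hasDerivAt_derivFst hB' (x 0) (x 2)) h0')
  have e1 := fderiv_single_eq (i := 1) (hd 1)
    (hasDerivAt_gaussKernel (r := x 1) ((hasDerivAt_derivSnd hA (x 0) (x 1)).sub_const
      (B (x 0, x 2))) ((hasDerivAt_derivSnd (contDiff_derivFst hA) (x 0) (x 1)).sub_const
        (derivFst B (x 0, x 2))) (hasDerivAt_const _ (derivSnd B (x 0, x 2))) h0').fun_neg
  have e2 := fderiv_single_eq (i := 2) (hd 2)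
    (hasDerivAt_gaussKernel (r := x 2) ((hasDerivAt_derivSnd hB (x 0) (x 2)).const_sub
      (A (x 0, x 1))) ((hasDerivAt_derivSnd (contDiff_derivFst hB) (x 0) (x 2)).const_sub
        (derivFst A (x 0, x 1))) (hasDerivAt_const _ (derivSnd A (x 0, x 1))) h0').fun_neg
  rw [Fin.sum_univ_three, e0, e1, e2, derivSnd_derivFst hA, derivSnd_derivFst hB]
  exact gaussKernel_closed _ (derivFst A (x 0, x 1) - derivFst B (x 0, x 2))
    (derivSnd A (x 0, x 1)) (derivSnd B (x 0, x 2)) (derivFst (derivSnd A) (x 0, x 1))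
    (derivFst (derivSnd B) (x 0, x 2)) h0'

/-- The integral of the Gauss kernel over a lateral face of a large box is small. -/
theorem tendsto_lateral {A B : ℝ × ℝ → ℝ × ℂ} {R : ℝ} {z w : ℝ → ℂ} (hA : IsLongFamily A R z)
    (hB : IsLongFamily B R w) (hre : ∀ u ∈ Icc (0 : ℝ) 1, (z u).re = (w u).re) {σ : ℝ}
    (hσ : |σ| = 1) :
    Tendsto (fun r => ∫ x in Icc (![0, -r] : Fin 2 → ℝ) ![1, r],
      gaussKernel (A (x 0, σ * r) - B (x 0, x 1))
        (derivFst A (x 0, σ * r) - derivFst B (x 0, x 1)) (derivSnd B (x 0, x 1)))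
      atTop (𝓝 0) := by
  have hK : IsCompact (Icc (0 : ℝ) 1 ×ˢ Icc (-|R|) |R|) := isCompact_Icc.prod isCompact_Icc
  obtain ⟨c, hc⟩ := hK.exists_bound_of_continuousOn (f := fun q => derivFst A (q.1, |R|) - derivFst B q)
    (((contDiff_derivFst hA.contDiff).continuous.comp (by fun_prop)).sub
      (contDiff_derivFst hB.contDiff).continuous).continuousOn
  obtain ⟨d, hd⟩ := hK.exists_bound_of_continuousOn (f := derivSnd B)
    (contDiff_derivSnd hB.contDiff).continuous.continuousOn
  obtain ⟨e, he⟩ := hK.exists_bound_of_continuousOn (f := fun q => (B q).1)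
    (continuous_fst.comp hB.contDiff.continuous).continuousOn
  have hR : R ≤ |R| := le_abs_self R
  have hRR : R ≤ |(|R|)| := by rwa [abs_abs]
  -- Only the part `|t| ≤ |R|` of the face, of area independent of `r`, contributes. There `B` stays
  -- within height `e` while `A` is at height `±r`, so the distance is at least `r - e`.
  have key : ∀ᶠ r in atTop, ‖∫ x in Icc (![0, -r] : Fin 2 → ℝ) ![1, r],
      gaussKernel (A (x 0, σ * r) - B (x 0, x 1))
        (derivFst A (x 0, σ * r) - derivFst B (x 0, x 1)) (derivSnd B (x 0, x 1))‖ ≤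
      6 * (c * d) / (r - e) ^ 2 * volume.real (Icc (![0, -|R|] : Fin 2 → ℝ) ![1, |R|]) := by
    filter_upwards [eventually_gt_atTop e, eventually_gt_atTop |R|] with r hr1 hr2
    have hr : R ≤ |σ * r| := by
      rw [abs_mul, hσ, one_mul]
      exact hR.trans (hr2.le.trans (le_abs_self r))
    have hsub : Icc (![0, -|R|] : Fin 2 → ℝ) ![1, |R|] ⊆ Icc ![0, -r] ![1, r] := by
      refine Icc_subset_Icc ?_ ?_ <;> intro i <;> fin_cases i <;> simp [hr2.le]
    rw [setIntegral_eq_of_subset_of_forall_sdiff_eq_zero measurableSet_Icc hsub]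
    · refine norm_setIntegral_le_of_norm_le_const measure_Icc_lt_top fun x hx => ?_
      have hu : x 0 ∈ Icc (0 : ℝ) 1 := ⟨hx.1 0, hx.2 0⟩
      have ht : x 1 ∈ Icc (-|R|) |R| := ⟨hx.1 1, hx.2 1⟩
      refine abs_gaussKernel_le_of_le (by linarith) ?_ ?_ (hd (x 0, x 1) ⟨hu, ht⟩)
      · rw [hA.eq_line _ hu _ hr]
        refine le_trans ?_ (norm_fst_le _)
        refine le_trans ?_ (norm_sub_norm_le _ _)
        have h1 : ‖(B (x 0, x 1)).1‖ ≤ e := he (x 0, x 1) ⟨hu, ht⟩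
        have h2 : ‖σ * r‖ = |r| := by rw [Real.norm_eq_abs, abs_mul, hσ, one_mul]
        rw [h2]
        linarith [le_abs_self r]
      -- The homotopy velocity at the parameter `σ * r` equals the one at `|R|`, which gives a bound
      -- uniform in `r`.
      · rw [hA.derivFst_eq hu hr hRR]
        exact hc (x 0, x 1) ⟨hu, ht⟩
    · intro x hx
      have hu : x 0 ∈ Icc (0 : ℝ) 1 := ⟨hx.1.1 0, hx.1.2 0⟩
      have ht : |R| < |x 1| := by
        by_contra h
        have h' := abs_le.mp (not_lt.mp h)
        refine hx.2 ⟨fun i => ?_, fun i => ?_⟩ <;> fin_cases i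
        · exact hu.1
        · exact h'.1
        · exact hu.2
        · exact h'.2
      -- Both curves are on their lines for every `v`, so the difference stays in the plane `re =
      -- 0`. Hence so does its derivative in `v`, and the velocity of `B` is `(1, 0)`: the three
      -- arguments of the kernel are coplanar.
      have hy : ∀ v ∈ Icc (0 : ℝ) 1, (A (v, σ * r) - B (v, x 1)).2.re = 0 := fun v hv => by
        rw [hA.eq_line v hv _ hr, hB.eq_line v hv _ (hR.trans ht.le)]
        simp [hre v hv]
      refine gaussKernel_of_re_eq_zero (hy _ hu) ?_ ?_
      · have h1 : HasDerivAt (fun v => (A (v, σ * r) - B (v, x 1)).2.re)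
            (derivFst A (x 0, σ * r) - derivFst B (x 0, x 1)).2.re (x 0) :=
          Complex.reCLM.hasFDerivAt.comp_hasDerivAt _ ((hasDerivAt_derivFst hA.contDiff _ _).sub
            (hasDerivAt_derivFst hB.contDiff _ _)).snd
        exact HasDerivAt.unique_of_eqOn_Icc hu h1 (hasDerivAt_const _ (0 : ℝ)) hy
      · have h1 := (hasDerivAt_derivSnd hB.contDiff (x 0) (x 1)).deriv
        rw [(hB.isLong hu).deriv_eq (hR.trans_lt ht)] at h1
        simp [← h1]
  refine squeeze_zero_norm' key ?_
  have h1 : Tendsto (fun r : ℝ => (r - e) ^ 2) atTop atTop :=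
    (tendsto_pow_atTop two_ne_zero).comp (tendsto_atTop_add_const_right _ (-e) tendsto_id)
  simpa using (h1.const_div_atTop (6 * (c * d))).mul_const
    (volume.real (Icc (![0, -|R|] : Fin 2 → ℝ) ![1, |R|]))

/-- Exhaustion by squares, valid by integrability; it also transfers the integral from `Fin 2 → ℝ`,
where the faces of the box live, to `ℝ × ℝ`. -/
theorem tendsto_setIntegral_linkingIntegrand {a b : ℝ → ℝ × ℂ} (h : Integrable (linkingIntegrand a b)) :
    Tendsto (fun r => ∫ x in Icc (![-r, -r] : Fin 2 → ℝ) ![r, r], linkingIntegrand a b (x 0, x 1))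
      atTop (𝓝 (∫ p, linkingIntegrand a b p)) := by
  have hmp := volume_preserving_finTwoArrow ℝ
  have h1 : Integrable fun x : Fin 2 → ℝ => linkingIntegrand a b (x 0, x 1) :=
    (hmp.integrable_comp_emb (MeasurableEquiv.measurableEmbedding _)).mpr h
  have h2 : ∫ x : Fin 2 → ℝ, linkingIntegrand a b (x 0, x 1) = ∫ p, linkingIntegrand a b p :=
    hmp.integral_comp (MeasurableEquiv.measurableEmbedding _) _
  have hun : ⋃ r : ℝ, Icc (![-r, -r] : Fin 2 → ℝ) ![r, r] = univ := by
    refine eq_univ_of_forall fun x => mem_iUnion.mpr ⟨max |x 0| |x 1|, ?_⟩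
    have e0 := abs_le.mp (le_max_left |x 0| |x 1|)
    have e1 := abs_le.mp (le_max_right |x 0| |x 1|)
    refine ⟨fun i => ?_, fun i => ?_⟩ <;> fin_cases i
    · exact e0.1
    · exact e1.1
    · exact e0.2
    · exact e1.2
  have := tendsto_setIntegral_of_monotone (μ := volume)
    (s := fun r : ℝ => Icc (![-r, -r] : Fin 2 → ℝ) ![r, r]) (fun _ => measurableSet_Icc)
    (fun r r' hr => Icc_subset_Icc (fun i => by fin_cases i <;> simpa using hr)
      (fun i => by fin_cases i <;> simpa using hr)) h1.integrableOn
  rwa [hun, setIntegral_univ, h2] at this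

/-- Homotopy invariance of the linking number. -/
theorem linkingNumber_eq_of_homotopy {A B : ℝ × ℝ → ℝ × ℂ} {R : ℝ} {z w : ℝ → ℂ}
    (hA : IsLongFamily A R z) (hB : IsLongFamily B R w)
    (hre : ∀ u ∈ Icc (0 : ℝ) 1, (z u).re = (w u).re)
    (hAB : ∀ u ∈ Icc (0 : ℝ) 1, ∀ s t, A (u, s) ≠ B (u, t)) :
    linkingNumber (fun s => A (0, s)) (fun t => B (0, t)) =
      linkingNumber (fun s => A (1, s)) (fun t => B (1, t)) := by
  have h0 : (0 : ℝ) ∈ Icc (0 : ℝ) 1 := ⟨le_rfl, zero_le_one⟩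
  have h1 : (1 : ℝ) ∈ Icc (0 : ℝ) 1 := ⟨zero_le_one, le_rfl⟩
  have lim (u : ℝ) (hu : u ∈ Icc (0 : ℝ) 1) := tendsto_setIntegral_linkingIntegrand
    ((hA.isLong hu).integrable (hB.isLong hu) (hAB u hu))
  have latA (σ : ℝ) (hσ : |σ| = 1) := tendsto_lateral hA hB hre hσ
  have latB (σ : ℝ) (hσ : |σ| = 1) := tendsto_lateral hB hA (fun u hu => (hre u hu).symm) hσ
  -- The limit of the signed sum over the six faces. For each `r ≥ 0` that sum is zero, and the
  -- lateral terms tend to zero, so the two end faces have the same limit.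
  have htot := ((((lim 1 h1).sub (lim 0 h0)).sub ((latA 1 abs_one).sub
    (latA (-1) (by simp)))).sub ((latB 1 abs_one).sub (latB (-1) (by simp))))
  have hlim := htot.congr' (f₂ := fun _ => (0 : ℝ)) (by
    filter_upwards [eventually_ge_atTop 0] with r hr
    have hne : ∀ x ∈ Icc (![0, -r, -r] : Fin 3 → ℝ) ![1, r, r], A (x 0, x 1) ≠ B (x 0, x 2) :=
      fun x hx => hAB _ ⟨hx.1 0, hx.2 0⟩ _ _
    have key := sum_faces_eq_zero hr (gaussField A B)
      (fun x hx => differentiableAt_gaussField hA.contDiff hB.contDiff (hne x hx))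
      (fun x hx => div_gaussField hA.contDiff hB.contDiff (hne x hx))
    have g0 (c : ℝ) (p : ℝ × ℝ) : linkingIntegrand (fun s => A (c, s)) (fun t => B (c, t)) p =
        gaussField A B 0 ![c, p.1, p.2] := by
      simp only [linkingIntegrand, (hasDerivAt_derivSnd hA.contDiff _ _).deriv,
        (hasDerivAt_derivSnd hB.contDiff _ _).deriv]
      rfl
    have g1 (c : ℝ) (x : Fin 2 → ℝ) : gaussKernel (A (x 0, c) - B (x 0, x 1))
        (derivFst A (x 0, c) - derivFst B (x 0, x 1)) (derivSnd B (x 0, x 1)) =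
        -gaussField A B 1 ![x 0, c, x 1] := (neg_neg _).symm
    -- The third component of the field is the second one with the two families exchanged, so the
    -- estimate for lateral faces applies with `B` and `A` interchanged.
    have g2 (c : ℝ) (x : Fin 2 → ℝ) : gaussKernel (B (x 0, c) - A (x 0, x 1))
        (derivFst B (x 0, c) - derivFst A (x 0, x 1)) (derivSnd A (x 0, x 1)) =
        -gaussField A B 2 ![x 0, x 1, c] := by
      rw [← gaussKernel_neg_neg, neg_sub, neg_sub]
      exact (neg_neg _).symm
    simp only [g0, g1, g2, integral_neg, one_mul, neg_one_mul]
    linarith)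
  have := tendsto_nhds_unique tendsto_const_nhds hlim
  rw [linkingNumber_eq_integral, linkingNumber_eq_integral]
  congr 1
  linarith

/-! ## Affine invariance -/

/-- The linking number is invariant under the maps `(x, y) ↦ (α x + β, ε y + c)`. -/
theorem linkingNumber_affine {a b : ℝ → ℝ × ℂ} {R : ℝ} {z w : ℂ} (ha : IsLong a R z)
    (hb : IsLong b R w) (hre : z.re = w.re) (hab : ∀ s t, a s ≠ b t) {α ε : ℝ} (hα : 0 < α)
    (hε : 0 < ε) (β : ℝ) (c : ℂ) :
    linkingNumber (fun s => (α * (a (α⁻¹ * (s - β))).1 + β, ε • (a (α⁻¹ * (s - β))).2 + c))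
      (fun s => (α * (b (α⁻¹ * (s - β))).1 + β, ε • (b (α⁻¹ * (s - β))).2 + c)) =
    linkingNumber a b := by
  -- The affine map is joined to the identity through maps with factors `α ^ u` and `ε ^ u` and
  -- translations by `u β` and `u c`. Writing the powers as exponentials keeps them positive and
  -- smooth for all real `u`. The reparametrization `q` inverts the map on the first coordinate, so
  -- that the ends remain of the form `s ↦ (s, ·)`.
  let q (p : ℝ × ℝ) : ℝ := Real.exp (-(p.1 * Real.log α)) * (p.2 - p.1 * β)
  let A (a : ℝ → ℝ × ℂ) (p : ℝ × ℝ) : ℝ × ℂ :=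
    (Real.exp (p.1 * Real.log α) * (a (q p)).1 + p.1 * β,
      Real.exp (p.1 * Real.log ε) • (a (q p)).2 + p.1 • c)
  have hq : ContDiff ℝ ∞ q := by
    unfold q
    fun_prop
  have hqR : ∀ u ∈ Icc (0 : ℝ) 1, ∀ s, |R| * Real.exp |Real.log α| + |β| ≤ |s| →
      R ≤ |q (u, s)| := by
    intro u hu s hs
    have h1 : |u * β| ≤ |β| := by
      rw [abs_mul, abs_of_nonneg hu.1]
      exact mul_le_of_le_one_left (abs_nonneg _) hu.2
    have h2 : u * Real.log α ≤ |Real.log α| := by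
      refine (le_abs_self _).trans ?_
      rw [abs_mul, abs_of_nonneg hu.1]
      exact mul_le_of_le_one_left (abs_nonneg _) hu.2
    have h3 : |R| * Real.exp |Real.log α| ≤ |s - u * β| := by
      have := abs_sub_abs_le_abs_sub s (u * β)
      linarith
    refine (le_abs_self R).trans ?_
    simp only [q]
    rw [abs_mul, Real.abs_exp, Real.exp_neg, inv_mul_eq_div, le_div_iff₀ (Real.exp_pos _)]
    refine le_trans ?_ h3
    gcongr
  have hA {a : ℝ → ℝ × ℂ} {z : ℂ} (ha : IsLong a R z) :
      IsLongFamily (A a) (|R| * Real.exp |Real.log α| + |β|)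
        fun u => Real.exp (u * Real.log ε) • z + u • c := by
    have haq := ha.contDiff.comp hq
    refine ⟨?_, fun u hu s hs => ?_⟩
    · have h1 : ContDiff ℝ ∞ fun p => (a (q p)).1 := contDiff_fst.comp haq
      have h2 : ContDiff ℝ ∞ fun p => (a (q p)).2 := contDiff_snd.comp haq
      unfold A
      fun_prop
    · simp only [A, ha.eq_line _ (hqR u hu s hs)]
      simp only [q, Real.exp_neg]
      refine Prod.ext ?_ rfl
      have := (Real.exp_pos (u * Real.log α)).ne'
      field_simp
      ring
  have key := linkingNumber_eq_of_homotopy (hA ha) (hA hb) (fun u _ => by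
    simp only [Complex.add_re, Complex.smul_re, hre]) (by
    intro u _ s t h
    simp only [A, Prod.mk.injEq, add_left_inj] at h
    exact hab _ _ (Prod.ext (mul_left_cancel₀ (Real.exp_pos _).ne' h.1)
      (smul_right_injective ℂ (Real.exp_pos _).ne' h.2)))
  simp only [A, q, one_mul, zero_mul, inv_one, Real.exp_zero, sub_zero, add_zero, one_smul,
    zero_smul, Real.exp_neg, Real.exp_log hα, Real.exp_log hε, Prod.mk.eta] at key
  exact key.symm

/-! ## Concatenation -/

/-- The superposition of the curves `P` and `τ + Q`, both of which are close to `ℝ × {z}`. -/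
noncomputable def superpose (P Q : ℝ → ℝ × ℂ) (z : ℂ) (τ s : ℝ) : ℝ × ℂ :=
  P s + Q (s - τ) + (τ - s, -z)

theorem contDiff_superpose {P Q : ℝ → ℝ × ℂ} (hP : ContDiff ℝ ∞ P) (hQ : ContDiff ℝ ∞ Q) (z : ℂ) :
    ContDiff ℝ ∞ fun p : ℝ × ℝ => superpose P Q z p.1 p.2 := by
  unfold superpose
  have h1 := hP.comp (contDiff_snd (𝕜 := ℝ) (E := ℝ) (F := ℝ))
  have h2 := hQ.comp ((contDiff_snd (𝕜 := ℝ) (E := ℝ) (F := ℝ)).sub contDiff_fst)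
  exact (h1.add h2).add ((contDiff_fst.sub contDiff_snd).prodMk contDiff_const)

/-- The correction term `(τ - s, -z)` cancels a straight summand, so that the other summand remains.
-/
theorem superpose_eq_left {P Q : ℝ → ℝ × ℂ} {z : ℂ} {τ s : ℝ} (h : Q (s - τ) = (s - τ, z)) :
    superpose P Q z τ s = P s := by
  rw [superpose, h, add_assoc]
  simp

theorem superpose_eq_right {P Q : ℝ → ℝ × ℂ} {z : ℂ} {τ s : ℝ} (h : P s = (s, z)) :
    superpose P Q z τ s = Q (s - τ) + (τ, 0) := by
  rw [superpose, h, add_comm (s, z), add_assoc]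
  simp

theorem isLong_superpose {P Q : ℝ → ℝ × ℂ} {R : ℝ} {z : ℂ} (hP : IsLong P R z)
    (hQ : IsLong Q R z) (τ : ℝ) : IsLong (superpose P Q z τ) (R + |τ|) z := by
  refine ⟨(contDiff_superpose hP.contDiff hQ.contDiff z).comp
    (contDiff_const.prodMk contDiff_id), fun s hs => ?_⟩
  have h1 := abs_sub_abs_le_abs_sub s τ
  rw [superpose_eq_left (hQ.eq_line _ (by linarith)), hP.eq_line]
  linarith [abs_nonneg τ]

theorem deriv_superpose {P Q : ℝ → ℝ × ℂ} {R : ℝ} {z : ℂ} (hP : IsLong P R z)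
    (hQ : IsLong Q R z) (τ s : ℝ) :
    deriv (superpose P Q z τ) s = deriv P s + deriv Q (s - τ) + (-1, 0) :=
  (((hP.hasDerivAt s).add ((hQ.hasDerivAt (s - τ)).comp_sub_const s τ)).add
    (((hasDerivAt_id s).const_sub τ).prodMk (hasDerivAt_const s (-z)))).deriv

/-- Away from the parameter `τ` the curves `Q` and `Q'` are straight, and the correction term
cancels them together with their velocities `(1, 0)`. -/
theorem linkingIntegrand_superpose_eq {P Q P' Q' : ℝ → ℝ × ℂ} {R : ℝ} {z w : ℂ}
    (hP : IsLong P R z) (hQ : IsLong Q R z) (hP' : IsLong P' R w) (hQ' : IsLong Q' R w)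
    {τ : ℝ} {p : ℝ × ℝ} (h1 : R < |p.1 - τ|) (h2 : R < |p.2 - τ|) :
    linkingIntegrand (superpose P Q z τ) (superpose P' Q' w τ) p = linkingIntegrand P P' p := by
  rw [linkingIntegrand, linkingIntegrand, deriv_superpose hP hQ, deriv_superpose hP' hQ',
    hQ.deriv_eq h1, hQ'.deriv_eq h2, superpose_eq_left (hQ.eq_line _ h1.le),
    superpose_eq_left (hQ'.eq_line _ h2.le)]
  have h0 (v : ℝ × ℂ) : v + (1, 0) + (-1, 0) = v := by
    ext <;> simp
  rw [h0, h0]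

/-- Dominated convergence needs a bound independent of `τ`. For bounded `t` and large `|τ|` the
integrand is that of `P` and `P'`. For large `|t|` the inverse-square bound is uniform, because
neither the velocities nor the deviations of the first coordinates from the parameters depend on `τ`
in their bounds. -/
theorem exists_bound_superpose_strip {P Q P' Q' : ℝ → ℝ × ℂ} {R : ℝ} {z w : ℂ}
    (hP : IsLong P R z) (hQ : IsLong Q R z) (hP' : IsLong P' R w) (hQ' : IsLong Q' R w)
    (hPP : ∀ s t, P s ≠ P' t) :
    ∃ T C, ∀ τ, T ≤ |τ| → ∀ s t, |s| ≤ R →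
      |linkingIntegrand (superpose P Q z τ) (superpose P' Q' w τ) (s, t)| ≤
        C * (1 + t ^ 2)⁻¹ := by
  obtain ⟨C, hC⟩ := hP.exists_bound_strip hP' hPP R
  obtain ⟨c1, hc1, hP1⟩ := hP.exists_bound_deriv
  obtain ⟨c2, hc2, hQ1⟩ := hQ.exists_bound_deriv
  obtain ⟨c3, hc3, hP1'⟩ := hP'.exists_bound_deriv
  obtain ⟨c4, hc4, hQ1'⟩ := hQ'.exists_bound_deriv
  obtain ⟨d1, hd1, hP2⟩ := hP.exists_bound_fst
  obtain ⟨d2, hd2, hQ2⟩ := hQ.exists_bound_fst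
  obtain ⟨d3, hd3, hP2'⟩ := hP'.exists_bound_fst
  obtain ⟨d4, hd4, hQ2'⟩ := hQ'.exists_bound_fst
  have hn : ‖((-1, 0) : ℝ × ℂ)‖ = 1 := by simp [Prod.norm_def]
  set M := 2 * (d1 + d2 + d3 + d4 + |R|) + 1
  -- This threshold puts `s` with `|s| ≤ R` and `t` with `|t| ≤ M` both at distance greater than `R`
  -- from `τ`. The summand `1` in each velocity factor comes from the correction term of
  -- `superpose`.
  refine ⟨M + |R| + |R| + 1, max C (48 * ((c1 + c2 + 1) * (c3 + c4 + 1))), fun τ hτ s t hs => ?_⟩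
  have hpos : 0 < (1 + t ^ 2)⁻¹ := by positivity
  have hR := le_abs_self R
  have hM : 1 + |R| ≤ M := by
    unfold M
    linarith [abs_nonneg R]
  by_cases ht : |t| ≤ M
  · rw [linkingIntegrand_superpose_eq hP hQ hP' hQ']
    · exact (hC s t hs).trans (mul_le_mul_of_nonneg_right (le_max_left _ _) hpos.le)
    · have := abs_sub_abs_le_abs_sub τ s
      rw [abs_sub_comm]
      linarith [abs_nonneg R]
    · have := abs_sub_abs_le_abs_sub τ t
      rw [abs_sub_comm]
      linarith [abs_nonneg R]
  · push Not at ht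
    refine (abs_gaussKernel_le_of_half_le (by linarith [abs_nonneg R]) ?_ ?_ ?_).trans
      (mul_le_mul_of_nonneg_right (le_max_right C _) hpos.le)
    · refine le_trans ?_ (norm_fst_le _)
      have e1 := abs_le.mp (hP2 s)
      have e2 := abs_le.mp (hQ2 (s - τ))
      have e3 := abs_le.mp (hP2' t)
      have e4 := abs_le.mp (hQ2' (t - τ))
      have e5 := abs_le.mp (hs.trans hR)
      simp only [superpose, Prod.fst_sub, Prod.fst_add]
      rw [Real.norm_eq_abs, le_abs]
      unfold M at ht
      rcases abs_cases t with ⟨h, h'⟩ | ⟨h, h'⟩ <;> rw [h] at ht ⊢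
      · right; linarith
      · left; linarith
    · rw [deriv_superpose hP hQ]
      refine (norm_add_le _ _).trans (add_le_add ((norm_add_le _ _).trans ?_) hn.le)
      exact add_le_add (hP1 s) (hQ1 _)
    · rw [deriv_superpose hP' hQ']
      refine (norm_add_le _ _).trans (add_le_add ((norm_add_le _ _).trans ?_) hn.le)
      exact add_le_add (hP1' t) (hQ1' _)

theorem exists_bound_superpose {P Q P' Q' : ℝ → ℝ × ℂ} {R : ℝ} {z w : ℂ}
    (hP : IsLong P R z) (hQ : IsLong Q R z) (hP' : IsLong P' R w) (hQ' : IsLong Q' R w)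
    (hPP : ∀ s t, P s ≠ P' t) :
    ∃ T, ∃ bound : ℝ × ℝ → ℝ, Integrable bound ∧ (∀ p, 0 ≤ bound p) ∧ ∀ τ, T ≤ |τ| → ∀ p ∈ cross R,
      |linkingIntegrand (superpose P Q z τ) (superpose P' Q' w τ) p| ≤ bound p := by
  obtain ⟨T, C, hC⟩ := exists_bound_superpose_strip hP hQ hP' hQ' hPP
  obtain ⟨T', D, hD⟩ := exists_bound_superpose_strip hP' hQ' hP hQ fun s t => (hPP t s).symm
  refine ⟨max T T', crossBound C D R, integrable_crossBound C D R, crossBound_nonneg C D R,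
    fun τ hτ p hp => le_crossBound (fun hs => ?_) (fun ht => ?_) hp⟩
  · exact hC τ ((le_max_left _ _).trans hτ) p.1 p.2 hs
  · rw [← linkingIntegrand_swap]
    exact hD τ ((le_max_right _ _).trans hτ) p.2 p.1 ht

theorem eventually_lt_abs_sub (R s : ℝ) : ∀ᶠ T : ℝ in atTop, R < |s - T| := by
  filter_upwards [eventually_gt_atTop (R + s)] with T hT
  rw [abs_sub_comm]
  exact lt_of_lt_of_le (by linarith) (le_abs_self _)

theorem eventually_lt_abs_add (R s : ℝ) : ∀ᶠ T : ℝ in atTop, R < |s + T| := by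
  filter_upwards [eventually_gt_atTop (R - s)] with T hT
  exact lt_of_lt_of_le (by linarith) (le_abs_self _)

theorem IsLong.setIntegral_cross {a b : ℝ → ℝ × ℂ} {R : ℝ} {z w : ℂ} (ha : IsLong a R z)
    (hb : IsLong b R w) : ∫ p in cross R, linkingIntegrand a b p = ∫ p, linkingIntegrand a b p :=
  setIntegral_eq_integral_of_forall_compl_eq_zero fun _ hp =>
    ha.linkingIntegrand_eq_zero hb (notMem_cross.mp hp).1 (notMem_cross.mp hp).2

/-- At a fixed point the integrand is eventually that of `P` and `P'`, and the cross carries their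
whole linking integral. -/
theorem tendsto_setIntegral_cross {P Q P' Q' : ℝ → ℝ × ℂ} {R : ℝ} {z w : ℂ}
    (hP : IsLong P R z) (hQ : IsLong Q R z) (hP' : IsLong P' R w) (hQ' : IsLong Q' R w)
    (hPP : ∀ s t, P s ≠ P' t)
    (hne : ∀ τ, 0 ≤ τ → ∀ s t, superpose P Q z τ s ≠ superpose P' Q' w τ t) :
    Tendsto (fun T => ∫ p in cross R, linkingIntegrand (superpose P Q z T) (superpose P' Q' w T) p)
      atTop (𝓝 (∫ p, linkingIntegrand P P' p)) := by
  obtain ⟨T₀, bound, hb, -, hT⟩ := exists_bound_superpose hP hQ hP' hQ' hPP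
  rw [← hP.setIntegral_cross hP']
  refine tendsto_integral_filter_of_dominated_convergence bound ?_ ?_ hb.integrableOn
    (.of_forall fun p => tendsto_const_nhds.congr' ?_)
  · filter_upwards [eventually_ge_atTop 0] with T hT
    exact (continuous_linkingIntegrand (isLong_superpose hP hQ T).contDiff
      (isLong_superpose hP' hQ' T).contDiff (hne T hT)).aestronglyMeasurable
  · filter_upwards [eventually_ge_atTop T₀] with T hT'
    exact ae_restrict_of_forall_mem (measurableSet_cross R)
      (hT T (hT'.trans (le_abs_self T)))
  · filter_upwards [eventually_lt_abs_sub R p.1, eventually_lt_abs_sub R p.2] with T h1 h2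
    exact (linkingIntegrand_superpose_eq hP hQ hP' hQ' h1 h2).symm

/-- Moving the origin to the second piece exchanges the roles of the two pieces and reverses the
shift. The kernel sees only differences, so the translation in space does not matter. -/
theorem linkingIntegrand_superpose_add {P Q P' Q' : ℝ → ℝ × ℂ} {R : ℝ} {z w : ℂ}
    (hP : IsLong P R z) (hQ : IsLong Q R z) (hP' : IsLong P' R w) (hQ' : IsLong Q' R w)
    (T : ℝ) (p : ℝ × ℝ) :
    linkingIntegrand (superpose P Q z T) (superpose P' Q' w T) (p + (T, T)) =
      linkingIntegrand (superpose Q P z (-T)) (superpose Q' P' w (-T)) p := by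
  have key {P Q : ℝ → ℝ × ℂ} {z : ℂ} (s : ℝ) :
      superpose P Q z T (s + T) = superpose Q P z (-T) s + (T, 0) := by
    simp only [superpose, add_sub_cancel_right, sub_neg_eq_add]
    refine Prod.ext ?_ ?_ <;> simp <;> ring
  simp only [linkingIntegrand, Prod.fst_add, Prod.snd_add, key, add_sub_add_right_eq_sub,
    deriv_superpose hP hQ, deriv_superpose hP' hQ', deriv_superpose hQ hP,
    deriv_superpose hQ' hP', add_sub_cancel_right, sub_neg_eq_add]
  rw [add_comm (deriv P _), add_comm (deriv P' _)]

/-- After translating the parameters by `(T, T)`, the complement of the cross around `P`, `P'`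
eventually contains any given point, while the integrand becomes that of `Q` and `Q'`. -/
theorem tendsto_setIntegral_cross_compl {P Q P' Q' : ℝ → ℝ × ℂ} {R : ℝ} {z w : ℂ}
    (hP : IsLong P R z) (hQ : IsLong Q R z) (hP' : IsLong P' R w) (hQ' : IsLong Q' R w)
    (hQQ : ∀ s t, Q s ≠ Q' t)
    (hne : ∀ τ, 0 ≤ τ → ∀ s t, superpose P Q z τ s ≠ superpose P' Q' w τ t) :
    Tendsto (fun T => ∫ p in (cross R)ᶜ,
        linkingIntegrand (superpose P Q z T) (superpose P' Q' w T) p)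
      atTop (𝓝 (∫ p, linkingIntegrand Q Q' p)) := by
  obtain ⟨T₀, bound, hb, hb0, hT⟩ := exists_bound_superpose hQ hP hQ' hP' hQQ
  have hshift (T : ℝ) : ∫ p in (cross R)ᶜ,
      linkingIntegrand (superpose P Q z T) (superpose P' Q' w T) p =
      ∫ p, (cross R)ᶜ.indicator (linkingIntegrand (superpose P Q z T) (superpose P' Q' w T))
        (p + (T, T)) := by
    rw [integral_add_right_eq_self (μ := (volume : Measure (ℝ × ℝ))),
      integral_indicator (measurableSet_cross R).compl]
  simp only [hshift]
  refine tendsto_integral_filter_of_dominated_convergence bound ?_ ?_ hb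
    (.of_forall fun p => tendsto_const_nhds.congr' ?_)
  · filter_upwards [eventually_ge_atTop 0] with T hT
    have h1 := (continuous_linkingIntegrand (isLong_superpose hP hQ T).contDiff
      (isLong_superpose hP' hQ' T).contDiff (hne T hT)).measurable.indicator
        (measurableSet_cross R).compl
    exact (h1.comp (measurable_add_const _)).aestronglyMeasurable
  · filter_upwards [eventually_ge_atTop T₀] with T hT'
    refine .of_forall fun p => ?_
    by_cases h1 : p + (T, T) ∈ (cross R)ᶜ
    · rw [indicator_of_mem h1, linkingIntegrand_superpose_add hP hQ hP' hQ']
      by_cases h2 : p ∈ cross R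
      · exact hT (-T) (hT'.trans (by rw [abs_neg]; exact le_abs_self T)) p h2
      -- Off both crosses the integrand reduces to that of `Q` and `Q'` at parameters where these
      -- are straight, hence to zero.
      · rw [linkingIntegrand_superpose_eq hQ hP hQ' hP', hQ.linkingIntegrand_eq_zero hQ'
          (notMem_cross.mp h2).1 (notMem_cross.mp h2).2, norm_zero]
        · exact hb0 p
        · rw [sub_neg_eq_add]
          exact (notMem_cross.mp h1).1
        · rw [sub_neg_eq_add]
          exact (notMem_cross.mp h1).2
    · rw [indicator_of_notMem h1, norm_zero]
      exact hb0 p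
  · filter_upwards [eventually_lt_abs_add R p.1, eventually_lt_abs_add R p.2] with T h1 h2
    rw [indicator_of_mem (show p + (T, T) ∈ (cross R)ᶜ from notMem_cross.mpr ⟨h1, h2⟩),
      linkingIntegrand_superpose_add hP hQ hP' hQ', linkingIntegrand_superpose_eq hQ hP hQ' hP']
    · rwa [sub_neg_eq_add]
    · rwa [sub_neg_eq_add]

/-- The linking number is additive under concatenation. -/
theorem linkingNumber_superpose {P Q P' Q' : ℝ → ℝ × ℂ} {R : ℝ} {z w : ℂ}
    (hP : IsLong P R z) (hQ : IsLong Q R z) (hP' : IsLong P' R w) (hQ' : IsLong Q' R w)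
    (hre : z.re = w.re) (hPP : ∀ s t, P s ≠ P' t) (hQQ : ∀ s t, Q s ≠ Q' t)
    (hne : ∀ τ, 0 ≤ τ → ∀ s t, superpose P Q z τ s ≠ superpose P' Q' w τ t) :
    linkingNumber (superpose P Q z 0) (superpose P' Q' w 0) =
      linkingNumber P P' + linkingNumber Q Q' := by
  have fam (T : ℝ) {P Q : ℝ → ℝ × ℂ} {z : ℂ} (hP : IsLong P R z) (hQ : IsLong Q R z) :
      IsLongFamily (fun p => superpose P Q z (p.1 * T) p.2) (R + |T|) fun _ => z := by
    refine ⟨(contDiff_superpose hP.contDiff hQ.contDiff z).comp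
      ((contDiff_fst.mul contDiff_const).prodMk contDiff_snd), fun u hu s hs =>
      (isLong_superpose hP hQ (u * T)).eq_line s (le_trans ?_ hs)⟩
    rw [abs_mul, abs_of_nonneg hu.1]
    have := mul_le_of_le_one_left (abs_nonneg T) hu.2
    linarith
  -- Sliding the second pieces to the right is a homotopy with disjoint curves, so the linking
  -- number may be computed in the limit `T → ∞`.
  have hconst (T : ℝ) (hT : 0 ≤ T) : linkingNumber (superpose P Q z 0) (superpose P' Q' w 0) =
      linkingNumber (superpose P Q z T) (superpose P' Q' w T) := by
    have := linkingNumber_eq_of_homotopy (fam T hP hQ) (fam T hP' hQ') (fun _ _ => hre)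
      fun u hu => hne (u * T) (mul_nonneg hu.1 hT)
    simpa using this
  have hlim := ((tendsto_setIntegral_cross hP hQ hP' hQ' hPP hne).add
    (tendsto_setIntegral_cross_compl hP hQ hP' hQ' hQQ hne)).const_mul (1 / (4 * Real.pi))
  have := tendsto_nhds_unique (tendsto_const_nhds
    (x := linkingNumber (superpose P Q z 0) (superpose P' Q' w 0))) (hlim.congr' (by
      filter_upwards [eventually_ge_atTop 0] with T hT
      rw [hconst T hT, linkingNumber_eq_integral, integral_add_compl (measurableSet_cross R)
        ((isLong_superpose hP hQ T).integrable (isLong_superpose hP' hQ' T) (hne T hT))]))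
  rw [this, mul_add, ← linkingNumber_eq_integral, ← linkingNumber_eq_integral]

/-! ## Concatenation of separated curves -/

/-- The long curve `P` is straight to the right of the plane at height `s₀`, the long curve `Q` is
straight to the left of it, and both stay on their side of the plane. -/
structure IsSeparated (P Q : ℝ → ℝ × ℂ) (R s₀ : ℝ) (z : ℂ) : Prop where
  left : IsLong P R z
  right : IsLong Q R z
  left_eq : ∀ s, s₀ ≤ s → P s = (s, z)
  left_lt : ∀ s, s < s₀ → (P s).1 < s₀
  right_eq : ∀ s, s ≤ s₀ → Q s = (s, z)
  right_le : ∀ s, s₀ ≤ s → s₀ ≤ (Q s).1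

theorem IsSeparated.superpose_of_lt {P Q : ℝ → ℝ × ℂ} {R s₀ : ℝ} {z : ℂ}
    (h : IsSeparated P Q R s₀ z) {τ s : ℝ} (hτ : 0 ≤ τ) (hs : s < s₀) :
    superpose P Q z τ s = P s := superpose_eq_left (h.right_eq _ (by linarith))

theorem IsSeparated.superpose_of_le {P Q : ℝ → ℝ × ℂ} {R s₀ : ℝ} {z : ℂ}
    (h : IsSeparated P Q R s₀ z) {τ s : ℝ} (hs : s₀ ≤ s) :
    superpose P Q z τ s = Q (s - τ) + (τ, 0) := superpose_eq_right (h.left_eq _ hs)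

theorem IsSeparated.le_fst {P Q : ℝ → ℝ × ℂ} {R s₀ : ℝ} {z : ℂ}
    (h : IsSeparated P Q R s₀ z) {τ s : ℝ} (hτ : 0 ≤ τ) (hs : s₀ ≤ s) :
    s₀ ≤ (Q (s - τ) + (τ, 0)).1 := by
  rw [Prod.fst_add]
  rcases le_total s₀ (s - τ) with h1 | h1
  · linarith [h.right_le _ h1]
  · rw [h.right_eq _ h1]
    simpa using hs

/-- During the slide the first pieces stay strictly below the height `s₀`, and the second ones,
moving to the right, stay at or above it. Collisions could only occur within a piece, where they are
excluded. -/
theorem IsSeparated.linkingNumber_superpose {P Q P' Q' : ℝ → ℝ × ℂ} {R s₀ : ℝ} {z w : ℂ}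
    (h : IsSeparated P Q R s₀ z) (h' : IsSeparated P' Q' R s₀ w) (hre : z.re = w.re)
    (hPP : ∀ s t, P s ≠ P' t) (hQQ : ∀ s t, Q s ≠ Q' t) :
    linkingNumber (superpose P Q z 0) (superpose P' Q' w 0) =
      linkingNumber P P' + linkingNumber Q Q' := by
  refine StringLinks.linkingNumber_superpose h.left h.right h'.left h'.right hre hPP hQQ
    fun τ hτ s t e => ?_
  rcases lt_or_ge s s₀ with hs | hs <;> rcases lt_or_ge t s₀ with ht | ht
  · rw [h.superpose_of_lt hτ hs, h'.superpose_of_lt hτ ht] at e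
    exact hPP _ _ e
  · rw [h.superpose_of_lt hτ hs, h'.superpose_of_le ht] at e
    exact absurd (h'.le_fst hτ ht) (not_le.mpr (e ▸ h.left_lt s hs))
  · rw [h.superpose_of_le hs, h'.superpose_of_lt hτ ht] at e
    exact absurd (h.le_fst hτ hs) (not_le.mpr (e ▸ h'.left_lt t ht))
  · rw [h.superpose_of_le hs, h'.superpose_of_le ht, add_left_inj] at e
    exact hQQ _ _ e

/-! ## Curves in the tube and maps of the tube -/

/-- The curve `a` in the tube is smooth, straight outside of `[-1, 1] × D²`, and maps `(-1, 1)` to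
points whose first coordinate is in `(-1, 1)`. -/
structure IsTubeCurve (a : ℝ → Tube) (z : Metric.closedBall (0 : ℂ) 1) : Prop where
  contDiff : ContDiff ℝ ∞ fun s => incl (a s)
  eq_line : ∀ s, s ∉ Ioo (-1 : ℝ) 1 → a s = (s, z)
  mem_Ioo : ∀ s ∈ Ioo (-1 : ℝ) 1, (a s).1 ∈ Ioo (-1 : ℝ) 1

/-- The embedding `E` of the tube in itself is smooth, equal to `id × φ` for a homothety `φ` outside
of `[-1, 1] × D²`, and preserves the interior of `[-1, 1] × D²`. -/
structure IsTubeMap (E : Tube → Tube) (φ : Metric.closedBall (0 : ℂ) 1 → Metric.closedBall (0 : ℂ) 1) :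
    Prop where
  immersion : IsSmoothImmersion E
  injective : Function.Injective E
  eq_std : ∀ p : Tube, p.1 ∉ Ioo (-1 : ℝ) 1 → E p = (p.1, φ p.2)
  mem_Ioo : ∀ p : Tube, p.1 ∈ Ioo (-1 : ℝ) 1 → (E p).1 ∈ Ioo (-1 : ℝ) 1
  affine : ∃ ε : ℝ, 0 < ε ∧ ∃ c : ℂ, ∀ z, (φ z : ℂ) = ε • (z : ℂ) + c

theorem notMem_Ioo_of_one_le_abs {s : ℝ} (hs : 1 ≤ |s|) : s ∉ Ioo (-1 : ℝ) 1 :=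
  fun h => not_lt.mpr hs (abs_lt.mpr h)

theorem IsTubeCurve.isLong {a : ℝ → Tube} {z : Metric.closedBall (0 : ℂ) 1} (ha : IsTubeCurve a z) :
    IsLong (fun s => incl (a s)) 1 z :=
  ⟨ha.contDiff, fun s hs => by rw [ha.eq_line s (notMem_Ioo_of_one_le_abs hs)]; rfl⟩

theorem isTubeCurve_line (z : Metric.closedBall (0 : ℂ) 1) : IsTubeCurve (fun s => (s, z)) z :=
  ⟨contDiff_line z, fun _ _ => rfl, fun _ hs => hs⟩

theorem IsTubeMap.comp_curve {E : Tube → Tube}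
    {φ : Metric.closedBall (0 : ℂ) 1 → Metric.closedBall (0 : ℂ) 1} (hE : IsTubeMap E φ)
    {a : ℝ → Tube} {z : Metric.closedBall (0 : ℂ) 1} (ha : IsTubeCurve a z) :
    IsTubeCurve (fun s => E (a s)) (φ z) := by
  obtain ⟨F, hF, hFE, -⟩ := hE.immersion
  refine ⟨?_, fun s hs => ?_, fun s hs => hE.mem_Ioo _ (ha.mem_Ioo s hs)⟩
  · simp only [← hFE]
    exact hF.comp ha.contDiff
  · rw [ha.eq_line s hs, hE.eq_std _ hs]

theorem IsTubeMap.comp {E E' : Tube → Tube}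
    {φ φ' : Metric.closedBall (0 : ℂ) 1 → Metric.closedBall (0 : ℂ) 1} (hE : IsTubeMap E φ)
    (hE' : IsTubeMap E' φ') : IsTubeMap (E ∘ E') (φ ∘ φ') := by
  obtain ⟨ε, hε, c, h⟩ := hE.affine
  obtain ⟨ε', hε', c', h'⟩ := hE'.affine
  refine ⟨hE.immersion.comp hE'.immersion, hE.injective.comp hE'.injective, fun p hp => ?_,
    fun p hp => hE.mem_Ioo _ (hE'.mem_Ioo p hp), ε * ε', mul_pos hε hε', ε • c' + c, fun z => ?_⟩
  · rw [Function.comp_apply, hE'.eq_std p hp, hE.eq_std (p.1, φ' p.2) hp]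
    rfl
  · rw [Function.comp_apply, h, h', smul_add, mul_smul, add_assoc]

theorem IsTubeMap.isLong_curve {E : Tube → Tube}
    {φ : Metric.closedBall (0 : ℂ) 1 → Metric.closedBall (0 : ℂ) 1} (hE : IsTubeMap E φ)
    (z : Metric.closedBall (0 : ℂ) 1) : IsLong (curve E z) 1 (φ z) :=
  (hE.comp_curve (isTubeCurve_line z)).isLong

theorem IsTubeCurve.end_ne {a b : ℝ → Tube} {z w : Metric.closedBall (0 : ℂ) 1}
    (ha : IsTubeCurve a z) (hb : IsTubeCurve b w) (hab : ∀ s t, a s ≠ b t) : z ≠ w := by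
  rintro rfl
  refine hab 1 1 ?_
  rw [ha.eq_line 1 (by simp), hb.eq_line 1 (by simp)]

/-- The translate of a curve by `β` along the tube. -/
def translate (a : ℝ → Tube) (β s : ℝ) : Tube := ((a (s - β)).1 + β, (a (s - β)).2)

/-- The slide takes place inside the source tube, so injectivity of `E` keeps the images disjoint.
The shift `2` moves the nontrivial part from `[-1, 1]` to `[1, 3]`, beyond the part of the tube
where `E` is not standard. -/
theorem linkingNumber_translate {E : Tube → Tube}
    {φ : Metric.closedBall (0 : ℂ) 1 → Metric.closedBall (0 : ℂ) 1} (hE : IsTubeMap E φ)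
    {a b : ℝ → Tube} {z w : Metric.closedBall (0 : ℂ) 1} (ha : IsTubeCurve a z)
    (hb : IsTubeCurve b w) (hre : (φ z : ℂ).re = (φ w : ℂ).re) (hab : ∀ s t, a s ≠ b t) :
    linkingNumber (fun s => incl (E (a s))) (fun s => incl (E (b s))) =
      linkingNumber (fun s => incl (E (translate a 2 s))) (fun s => incl (E (translate b 2 s))) := by
  obtain ⟨F, hF, hFE, -⟩ := hE.immersion
  have fam {a : ℝ → Tube} {z : Metric.closedBall (0 : ℂ) 1} (ha : IsTubeCurve a z) :
      IsLongFamily (fun p => incl (E (translate a (p.1 * 2) p.2))) 3 fun _ => (φ z : ℂ) := by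
    refine ⟨?_, fun u hu s hs => ?_⟩
    · have h1 : ∀ p : ℝ × ℝ, incl (translate a (p.1 * 2) p.2) =
          incl (a (p.2 - p.1 * 2)) + (p.1 * 2, 0) := fun p => by simp [incl, translate]
      simp only [← hFE, h1]
      refine hF.comp ((ha.contDiff.comp (contDiff_snd.sub (contDiff_fst.mul contDiff_const))).add
        ((contDiff_fst.mul contDiff_const).prodMk contDiff_const))
    · have h1 : s - u * 2 ∉ Ioo (-1 : ℝ) 1 := by
        refine notMem_Ioo_of_one_le_abs ?_
        have := abs_sub_abs_le_abs_sub s (u * 2)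
        rw [abs_of_nonneg (mul_nonneg hu.1 zero_le_two)] at this
        linarith [hu.2]
      have h2 : translate a (u * 2) s = (s, z) := by
        simp [translate, ha.eq_line _ h1]
      simp only [h2, hE.eq_std (s, z) (notMem_Ioo_of_one_le_abs (by linarith))]
      rfl
  have key := linkingNumber_eq_of_homotopy (fam ha) (fam hb) (fun _ _ => hre) (by
    intro u _ s t h
    have h := hE.injective (incl_injective h)
    simp only [translate, Prod.mk.injEq, add_left_inj] at h
    exact hab _ _ (Prod.ext h.1 h.2))
  simpa [translate] using key

/-- The linking number of the images of two curves under an embedding of the tube. -/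
theorem IsTubeMap.linkingNumber_comp {E : Tube → Tube}
    {φ : Metric.closedBall (0 : ℂ) 1 → Metric.closedBall (0 : ℂ) 1} (hE : IsTubeMap E φ)
    {a b : ℝ → Tube} {z w : Metric.closedBall (0 : ℂ) 1} (ha : IsTubeCurve a z)
    (hb : IsTubeCurve b w) (hre : (z : ℂ).re = (w : ℂ).re) (hab : ∀ s t, a s ≠ b t) :
    linkingNumber (fun s => incl (E (a s))) (fun s => incl (E (b s))) =
      linkingNumber (curve E z) (curve E w) +
        linkingNumber (fun s => incl (a s)) fun s => incl (b s) := by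
  obtain ⟨ε, hε, c, hφ⟩ := hE.affine
  have hreφ : (φ z : ℂ).re = (φ w : ℂ).re := by
    simp only [hφ, Complex.add_re, Complex.smul_re, hre]
  -- The image of the translated curve to the right of height `1`, where `E` is `id × φ`. To the
  -- left of it the translated curve is still the line over its end point, and its image is a
  -- parallel of `E`.
  let Q (a : ℝ → Tube) (s : ℝ) : ℝ × ℂ := ((a (s - 2)).1 + 2, (φ (a (s - 2)).2 : ℂ))
  have sep {a : ℝ → Tube} {z : Metric.closedBall (0 : ℂ) 1} (ha : IsTubeCurve a z) :
      IsSeparated (curve E z) (Q a) 3 1 (φ z) := by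
    have hQ : ∀ s, s - 2 ∉ Ioo (-1 : ℝ) 1 → Q a s = (s, (φ z : ℂ)) := fun s hs => by
      simp [Q, ha.eq_line _ hs]
    refine ⟨(hE.isLong_curve z).mono (by norm_num), ⟨?_, fun s hs => hQ s ?_⟩, fun s hs => ?_,
      fun s hs => ?_, fun s hs => hQ s fun h => ?_, fun s hs => ?_⟩
    · have h1 := ha.contDiff.comp ((contDiff_id (𝕜 := ℝ) (E := ℝ) (n := ∞)).sub
        (contDiff_const (c := (2 : ℝ))))
      simp only [Q, hφ]
      exact ((contDiff_fst.comp h1).add contDiff_const).prodMk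
        (((contDiff_snd.comp h1).const_smul ε).add contDiff_const)
    · refine notMem_Ioo_of_one_le_abs ?_
      have := abs_sub_abs_le_abs_sub s 2
      rw [abs_two] at this
      linarith
    · exact (hE.isLong_curve z).eq_line s (hs.trans (le_abs_self s))
    · change (E (s, z)).1 < 1
      by_cases h : s ∈ Ioo (-1 : ℝ) 1
      · exact (hE.mem_Ioo (s, z) h).2
      · rwa [hE.eq_std (s, z) h]
    · linarith [h.1]
    · by_cases h : s - 2 ∈ Ioo (-1 : ℝ) 1
      · have := (ha.mem_Ioo _ h).1
        simp only [Q]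
        linarith
      · rw [hQ s h]
        exact hs
  have hsup {a : ℝ → Tube} {z : Metric.closedBall (0 : ℂ) 1} (ha : IsTubeCurve a z) :
      (fun s => incl (E (translate a 2 s))) = superpose (curve E z) (Q a) (φ z) 0 := by
    funext s
    rcases lt_or_ge s 1 with hs | hs
    · rw [(sep ha).superpose_of_lt le_rfl hs]
      have h1 : s - 2 ∉ Ioo (-1 : ℝ) 1 := fun h => by linarith [h.1]
      simp [translate, ha.eq_line _ h1, curve]
    · rw [(sep ha).superpose_of_le hs]
      have h1 : (a (s - 2)).1 + 2 ∉ Ioo (-1 : ℝ) 1 := by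
        have h2 : (-1 : ℝ) ≤ (a (s - 2)).1 := by
          by_cases h : s - 2 ∈ Ioo (-1 : ℝ) 1
          · exact (ha.mem_Ioo _ h).1.le
          · rw [ha.eq_line _ h]
            linarith
        exact fun h => by linarith [h.2]
      rw [translate, hE.eq_std _ h1]
      simp [Q, incl]
  -- `Q` is the affine copy of the curve with horizontal factor `1`, shift `2` and the homothety `φ`
  -- on the disc.
  have hQQ : linkingNumber (Q a) (Q b) =
      linkingNumber (fun s => incl (a s)) fun s => incl (b s) := by
    rw [← linkingNumber_affine ha.isLong hb.isLong hre
      (fun s t h => hab s t (incl_injective h)) one_pos hε 2 c]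
    simp only [Q, hφ, inv_one, one_mul, incl]
  rw [linkingNumber_translate hE ha hb hreφ hab, hsup ha, hsup hb,
    (sep ha).linkingNumber_superpose (sep hb) hreφ, hQQ]
  · intro s t h
    have h := hE.injective (incl_injective h)
    exact ha.end_ne hb hab (congrArg Prod.snd h)
  · intro s t h
    simp only [Q, hφ, Prod.mk.injEq, add_left_inj] at h
    exact hab _ _ (Prod.ext h.1 (Subtype.ext (smul_right_injective ℂ hε.ne' h.2)))

/-- The convex combination of two points of the disc. -/
noncomputable def discMix (u : ℝ) (hu : u ∈ Icc (0 : ℝ) 1) (z w : Metric.closedBall (0 : ℂ) 1) :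
    Metric.closedBall (0 : ℂ) 1 :=
  ⟨(1 - u) • (z : ℂ) + u • (w : ℂ), convex_closedBall (0 : ℂ) 1 z.2 w.2 (sub_nonneg.mpr hu.2) hu.1
    (by ring)⟩

/-- A curve in one strand may be straightened without changing its linking number with a curve in
another strand. -/
theorem linkingNumber_straighten {E E' : Tube → Tube}
    {φ φ' : Metric.closedBall (0 : ℂ) 1 → Metric.closedBall (0 : ℂ) 1} (hE : IsTubeMap E φ)
    (hE' : IsTubeMap E' φ') (hEE : ∀ p q, E p ≠ E' q)
    {a b : ℝ → Tube} {z w : Metric.closedBall (0 : ℂ) 1} (ha : IsTubeCurve a z)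
    (hb : IsTubeCurve b w) (hre : (φ z : ℂ).re = (φ' w : ℂ).re) :
    linkingNumber (fun s => incl (E (a s))) (fun s => incl (E' (b s))) =
      linkingNumber (curve E z) (curve E' w) := by
  obtain ⟨F, hF, hFE, -⟩ := hE.immersion
  obtain ⟨F', hF', hFE', -⟩ := hE'.immersion
  -- Straight-line homotopy inside the tube, which is convex, followed by the strand. The two curves
  -- lie in different strands with disjoint images, so they cannot meet. The smooth extension `F`
  -- gives a family defined for all real parameters.
  let A (F : ℝ × ℂ → ℝ × ℂ) (a : ℝ → Tube) (z : Metric.closedBall (0 : ℂ) 1) (p : ℝ × ℝ) : ℝ × ℂ :=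
    F ((1 - p.1) • incl (a p.2) + p.1 • (p.2, (z : ℂ)))
  have fam {E F φ a z} (hE : IsTubeMap E φ) (hF : ContDiff ℝ ∞ F)
      (hFE : ∀ p, F (incl p) = incl (E p)) (ha : IsTubeCurve a z) :
      IsLongFamily (A F a z) 1 fun _ => (φ z : ℂ) := by
    refine ⟨hF.comp (((contDiff_const.sub contDiff_fst).smul (ha.contDiff.comp contDiff_snd)).add
      (contDiff_fst.smul (contDiff_snd.prodMk contDiff_const))), fun u _ s hs => ?_⟩
    have h1 := notMem_Ioo_of_one_le_abs hs
    have h2 : (1 - u) • incl (a s) + u • (s, (z : ℂ)) = incl (s, z) := by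
      rw [ha.eq_line s h1]
      change (1 - u) • ((s, z) : ℝ × ℂ) + u • (s, (z : ℂ)) = (s, (z : ℂ))
      rw [← add_smul, sub_add_cancel, one_smul]
    simp only [A, h2, hFE, hE.eq_std (s, z) h1]
    rfl
  have hval {E : Tube → Tube} {F a z} (hFE : ∀ p, F (incl p) = incl (E p)) {u : ℝ}
      (hu : u ∈ Icc (0 : ℝ) 1) (s : ℝ) :
      A F a z (u, s) = incl (E ((1 - u) * (a s).1 + u * s, discMix u hu (a s).2 z)) := by
    rw [← hFE]
    rfl
  have key := linkingNumber_eq_of_homotopy (fam hE hF hFE ha) (fam hE' hF' hFE' hb)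
    (fun _ _ => hre) fun u hu s t h => by
      rw [hval hFE hu, hval hFE' hu] at h
      exact hEE _ _ (incl_injective h)
  simp only [A, sub_zero, one_smul, zero_smul, add_zero, sub_self, zero_add, hFE, hFE'] at key
  rw [key]
  congr 1
  · funext s
    exact hFE (s, z)
  · funext s
    exact hFE' (s, w)

theorem FramedLongKnot.isTubeMap (f : FramedLongKnot) : IsTubeMap f id :=
  ⟨f.immersion, f.embedding.injective, f.eq_id', f.mem_Ioo, 1, one_pos, 0, fun z => by simp⟩

theorem FramedStringLink.isTubeMap_up (f : FramedStringLink) : IsTubeMap (f ∘ Sum.inl) iotaUp :=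
  ⟨f.immersion_up, f.embedding.injective.comp Sum.inl_injective, fun p hp => f.eq_std' (.inl p) hp,
    fun p hp => f.mem_Ioo (.inl p) hp, 1 / 8, by norm_num, _, fun _ => rfl⟩

theorem FramedStringLink.isTubeMap_down (f : FramedStringLink) : IsTubeMap (f ∘ Sum.inr) iotaDown :=
  ⟨f.immersion_down, f.embedding.injective.comp Sum.inr_injective,
    fun p hp => f.eq_std' (.inr p) hp, fun p hp => f.mem_Ioo (.inr p) hp, 1 / 8, by norm_num, _,
    fun _ => rfl⟩

/-- The linking number of two parallels of a framed long knot does not depend on their choice. -/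
theorem FramedLongKnot.linkingNumber_curve_eq (f : FramedLongKnot)
    {z w z' w' : Metric.closedBall (0 : ℂ) 1} (hre : (z : ℂ).re = (w : ℂ).re)
    (hre' : (z' : ℂ).re = (w' : ℂ).re) (him : (z : ℂ).im < (w : ℂ).im)
    (him' : (z' : ℂ).im < (w' : ℂ).im) :
    linkingNumber (curve f z) (curve f w) = linkingNumber (curve f z') (curve f w') := by
  obtain ⟨F, hF, hFf, -⟩ := f.immersion
  -- The two points of the disc move linearly. Their real parts remain equal and their imaginary
  -- parts remain strictly ordered, so the parallels stay disjoint.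
  let A (z z' : Metric.closedBall (0 : ℂ) 1) (p : ℝ × ℝ) : ℝ × ℂ :=
    F (p.2, (1 - p.1) • (z : ℂ) + p.1 • (z' : ℂ))
  have hval (z z' : Metric.closedBall (0 : ℂ) 1) {u : ℝ} (hu : u ∈ Icc (0 : ℝ) 1) (s : ℝ) :
      A z z' (u, s) = incl (f (s, discMix u hu z z')) := hFf (s, discMix u hu z z')
  have fam (z z' : Metric.closedBall (0 : ℂ) 1) :
      IsLongFamily (A z z') 1 fun u => (1 - u) • (z : ℂ) + u • (z' : ℂ) := by
    refine ⟨hF.comp (contDiff_snd.prodMk (((contDiff_const.sub contDiff_fst).smul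
      contDiff_const).add (contDiff_fst.smul contDiff_const))), fun u hu s hs => ?_⟩
    rw [hval z z' hu, f.eq_id' _ (notMem_Ioo_of_one_le_abs hs)]
    rfl
  have key := linkingNumber_eq_of_homotopy (fam z z') (fam w w')
    (fun u _ => by simp only [Complex.add_re, Complex.smul_re, hre, hre']) fun u hu s t h => by
      rw [hval z z' hu, hval w w' hu] at h
      have h1 := congrArg Prod.snd (f.embedding.injective (incl_injective h))
      have h2 := congrArg (fun v : Metric.closedBall (0 : ℂ) 1 => (v : ℂ).im) h1
      simp only [discMix, Complex.add_im, Complex.smul_im, smul_eq_mul] at h2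
      rcases hu.1.eq_or_lt with rfl | hu0
      · linarith
      · nlinarith [mul_lt_mul_of_pos_left him' hu0,
          mul_le_mul_of_nonneg_left him.le (sub_nonneg.mpr hu.2)]
  simp only [A, sub_zero, one_smul, zero_smul, add_zero, sub_self, zero_add] at key
  have hcurve (z : Metric.closedBall (0 : ℂ) 1) : curve f z = fun s => F (s, (z : ℂ)) :=
    funext fun s => (hFf (s, z)).symm
  rw [hcurve, hcurve, hcurve, hcurve]
  exact key

theorem linkingNumber_line (z w : ℂ) : linkingNumber (fun s => (s, z)) (fun s => (s, w)) = 0 := by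
  have h (p : ℝ × ℝ) : linkingIntegrand (fun s => (s, z)) (fun s => (s, w)) p = 0 := by
    rw [linkingIntegrand, (hasDerivAt_line z _).deriv, (hasDerivAt_line w _).deriv,
      gaussKernel_self]
  simp [linkingNumber_eq_integral, h]

/-! ## Framed long knots -/

theorem center_ne_top : center ≠ top := by
  intro h
  have := congrArg Subtype.val h
  exact Complex.I_ne_zero this.symm

theorem center_re : (center : ℂ).re = 0 := Complex.zero_re

theorem center_im : (center : ℂ).im = 0 := Complex.zero_im

theorem top_re : (top : ℂ).re = 0 := Complex.I_re

theorem top_im : (top : ℂ).im = 1 := Complex.I_im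

theorem curve_ne {f : Tube → Tube} (hf : Function.Injective f) {z w : Metric.closedBall (0 : ℂ) 1}
    (hzw : z ≠ w) (s t : ℝ) : f (s, z) ≠ f (t, w) :=
  fun h => hzw (congrArg Prod.snd (hf h))

theorem IsTubeMap.framingNumber_comp {E : Tube → Tube}
    {φ : Metric.closedBall (0 : ℂ) 1 → Metric.closedBall (0 : ℂ) 1} (hE : IsTubeMap E φ)
    (f : FramedLongKnot) : framingNumber (E ∘ f) = framingNumber E + framingNumber f :=
  hE.linkingNumber_comp (f.isTubeMap.comp_curve (isTubeCurve_line center))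
    (f.isTubeMap.comp_curve (isTubeCurve_line top)) (center_re.trans top_re.symm)
    (curve_ne f.embedding.injective center_ne_top)

/-- The framing number of the image of a framed strand under a framed long knot. -/
theorem FramedLongKnot.framingNumber_comp (f : FramedLongKnot) {E : Tube → Tube}
    {φ : Metric.closedBall (0 : ℂ) 1 → Metric.closedBall (0 : ℂ) 1} (hE : IsTubeMap E φ) :
    framingNumber (f ∘ E) = framingNumber f + framingNumber E := by
  obtain ⟨ε, hε, c, hφ⟩ := hE.affine
  have hre : (φ center : ℂ).re = (φ top : ℂ).re := by simp [hφ, center_re, top_re]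
  have him : (φ center : ℂ).im < (φ top : ℂ).im := by simp [hφ, center_im, top_im, hε]
  have h := f.isTubeMap.linkingNumber_comp (hE.comp_curve (isTubeCurve_line center))
    (hE.comp_curve (isTubeCurve_line top)) hre (curve_ne hE.injective center_ne_top)
  -- The homothety `φ` has positive ratio, so the images of `center` and `top` are again vertically
  -- aligned in the same order, and the parallels of `f` over them compute its framing number.
  rw [f.linkingNumber_curve_eq hre (center_re.trans top_re.symm) him
    (by simp [center_im, top_im])] at h
  exact h

/-- The trivial factor `1` and summand `0` on the disc coordinate bring the conjugate to the form of
`linkingNumber_affine`. -/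
theorem curve_conj (l : LittleInterval) (f : Tube → Tube) (z : Metric.closedBall (0 : ℂ) 1) :
    curve (l.tube ∘ f ∘ l.tubeInv) z = fun s => (l.a * (curve f z (l.a⁻¹ * (s - l.b))).1 + l.b,
      (1 : ℝ) • (curve f z (l.a⁻¹ * (s - l.b))).2 + 0) := by
  funext s
  have h : l.inv s = l.a⁻¹ * (s - l.b) := by
    rw [LittleInterval.inv]
    ring
  simp [curve, incl, LittleInterval.tube, LittleInterval.tubeInv, LittleInterval.map, h]

/-- Linking numbers are invariant under the action of little intervals. -/
theorem LittleInterval.linkingNumber_conj (l : LittleInterval) {E E' : Tube → Tube}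
    {φ φ' : Metric.closedBall (0 : ℂ) 1 → Metric.closedBall (0 : ℂ) 1} (hE : IsTubeMap E φ)
    (hE' : IsTubeMap E' φ') {z w : Metric.closedBall (0 : ℂ) 1}
    (hre : (φ z : ℂ).re = (φ' w : ℂ).re) (hne : ∀ s t, E (s, z) ≠ E' (t, w)) :
    linkingNumber (curve (l.tube ∘ E ∘ l.tubeInv) z) (curve (l.tube ∘ E' ∘ l.tubeInv) w) =
      linkingNumber (curve E z) (curve E' w) := by
  rw [curve_conj, curve_conj]
  exact linkingNumber_affine (hE.isLong_curve z) (hE'.isLong_curve w) hre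
    (fun s t h => hne s t (incl_injective h)) l.pos one_pos l.b 0

theorem actKnot_mem_fatLongKnots (l : LittleInterval) {f : FramedLongKnot}
    (hf : f ∈ fatLongKnots) : l.actKnot f ∈ fatLongKnots :=
  (l.linkingNumber_conj f.isTubeMap f.isTubeMap (center_re.trans top_re.symm)
    (curve_ne f.embedding.injective center_ne_top)).trans hf

/-- Framing numbers add under composition and are unchanged by little intervals. The argument
applies to composites along any list, hence to both the direct and the reverse action. -/
theorem kappaList_mem_fatLongKnots {ι : Type} (L : ι → LittleSquare) {f : ι → FramedLongKnot}
    (hf : ∀ i, f i ∈ fatLongKnots) (l : List ι) : kappaList L f l ∈ fatLongKnots := by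
  refine List.prod_induction (· ∈ fatLongKnots) (fun f g hf hg => ?_)
    (linkingNumber_line _ _) fun x hx => ?_
  · have h := f.isTubeMap.framingNumber_comp g
    rw [show framingNumber f = 0 from hf, show framingNumber g = 0 from hg, add_zero] at h
    exact h
  · obtain ⟨i, -, rfl⟩ := List.mem_map.mp hx
    exact actKnot_mem_fatLongKnots _ (hf i)

/-! ## Concatenation of framed string links -/

/-- The image of the line over a point of `D² ⊔ D²` under a framed string link. -/
def linkCurve (f : Tube ⊕ Tube → Tube)
    (x : Metric.closedBall (0 : ℂ) 1 ⊕ Metric.closedBall (0 : ℂ) 1) (s : ℝ) : ℝ × ℂ :=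
  incl (f (x.map (fun z => (s, z)) fun z => (s, z)))

/-- The embedding `ι` of two discs in the disc. -/
noncomputable def iota : Metric.closedBall (0 : ℂ) 1 ⊕ Metric.closedBall (0 : ℂ) 1 → ℂ :=
  Sum.elim (fun z => iotaUp z) fun z => iotaDown z

theorem incl_std (x : Metric.closedBall (0 : ℂ) 1 ⊕ Metric.closedBall (0 : ℂ) 1) (s : ℝ) :
    incl (std (x.map (fun z => (s, z)) fun z => (s, z))) = (s, iota x) := by
  rcases x with x | x <;> rfl

theorem height_map (x : Metric.closedBall (0 : ℂ) 1 ⊕ Metric.closedBall (0 : ℂ) 1) (s : ℝ) :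
    height (x.map (fun z => (s, z)) fun z => (s, z)) = s := by
  rcases x with x | x <;> rfl

theorem FramedStringLink.isLong_linkCurve (f : FramedStringLink)
    (x : Metric.closedBall (0 : ℂ) 1 ⊕ Metric.closedBall (0 : ℂ) 1) :
    IsLong (linkCurve f x) 1 (iota x) := by
  rcases x with z | z
  · exact f.isTubeMap_up.isLong_curve z
  · exact f.isTubeMap_down.isLong_curve z

theorem FramedStringLink.linkCurve_ne (f : FramedStringLink)
    {x y : Metric.closedBall (0 : ℂ) 1 ⊕ Metric.closedBall (0 : ℂ) 1} (hxy : x ≠ y) (s t : ℝ) :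
    linkCurve f x s ≠ linkCurve f y t := by
  intro h
  have h := f.embedding.injective (incl_injective h)
  rcases x with z | z <;> rcases y with w | w <;> simp at h hxy
  · exact hxy h.2
  · exact hxy h.2

theorem LittleInterval.linkingNumber_actLink (l : LittleInterval) (f : FramedStringLink)
    {x y : Metric.closedBall (0 : ℂ) 1 ⊕ Metric.closedBall (0 : ℂ) 1} (hxy : x ≠ y)
    (hre : (iota x).re = (iota y).re) :
    linkingNumber (linkCurve (l.actLink f) x) (linkCurve (l.actLink f) y) =
      linkingNumber (linkCurve f x) (linkCurve f y) := by
  have hne (s t : ℝ) (h : f (x.map (fun z => (s, z)) fun z => (s, z)) =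
    f (y.map (fun z => (t, z)) fun z => (t, z))) : False := f.linkCurve_ne hxy s t (congrArg incl h)
  rcases x with z | z <;> rcases y with w | w
  · exact l.linkingNumber_conj f.isTubeMap_up f.isTubeMap_up hre hne
  · exact l.linkingNumber_conj f.isTubeMap_up f.isTubeMap_down hre hne
  · exact l.linkingNumber_conj f.isTubeMap_down f.isTubeMap_up hre hne
  · exact l.linkingNumber_conj f.isTubeMap_down f.isTubeMap_down hre hne

theorem linkCurve_actLink_eq_line (l : LittleInterval) (f : FramedStringLink)
    (x : Metric.closedBall (0 : ℂ) 1 ⊕ Metric.closedBall (0 : ℂ) 1) {s : ℝ}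
    (hs : s ∉ Ioo (l.map (-1)) (l.map 1)) : linkCurve (l.actLink f) x s = (s, iota x) := by
  rw [linkCurve, l.actLink_eq_std f _ (by rwa [height_map]), incl_std]

theorem linkCurve_actLink_mem (l : LittleInterval) (f : FramedStringLink)
    (x : Metric.closedBall (0 : ℂ) 1 ⊕ Metric.closedBall (0 : ℂ) 1) {s : ℝ}
    (hs : s ∈ Ioo (l.map (-1)) (l.map 1)) :
    (linkCurve (l.actLink f) x s).1 ∈ Ioo (l.map (-1)) (l.map 1) :=
  l.actLink_mem f _ (by rwa [height_map])

/-- Among almost disjoint intervals, all others end before the one that starts last begins; its left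
end is the plane used for the separation. -/
theorem map_one_le_of_last {ι : Type} {l : ι → LittleInterval} {j : ι}
    (hj : ∀ i, (l i).map (-1) ≤ (l j).map (-1)) {i : ι}
    (hij : i ≠ j) (hl : Pairwise fun i j => (l i).AlmostDisjoint (l j)) :
    (l i).map 1 ≤ (l j).map (-1) := by
  have h := disjoint_Ioo hl i j hij
  rw [Ioo_disjoint_Ioo, max_eq_right (hj i)] at h
  have h1 := (l j).map_lt_map.mpr (show (-1 : ℝ) < 1 by norm_num)
  rcases min_le_iff.mp h with h | h
  · exact h
  · exact absurd h (not_le.mpr h1)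

theorem pairwise_remove {ι : Type} {l : ι → LittleInterval} (j : ι)
    (hl : Pairwise fun i j => (l i).AlmostDisjoint (l j)) :
    Pairwise fun i k : {i // i ≠ j} => (l i).AlmostDisjoint (l k) :=
  fun _ _ h => hl fun e => h (Subtype.ext e)

section Lambda

variable {ι : Type} [Fintype ι] {l : ι → LittleInterval}
  (hl : Pairwise fun i j => (l i).AlmostDisjoint (l j)) (f : ι → FramedStringLink)
  (x : Metric.closedBall (0 : ℂ) 1 ⊕ Metric.closedBall (0 : ℂ) 1)

theorem linkCurve_lambda_of_mem (i : ι) {s : ℝ} (hs : s ∈ Ioo ((l i).map (-1)) ((l i).map 1)) :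
    linkCurve (lambda l hl f) x s = linkCurve ((l i).actLink (f i)) x s :=
  congrArg incl (lambdaFun_of_mem hl f i _ (by rwa [height_map]))

theorem linkCurve_lambda_of_notMem {s : ℝ} (hs : ∀ i, s ∉ Ioo ((l i).map (-1)) ((l i).map 1)) :
    linkCurve (lambda l hl f) x s = (s, iota x) := by
  rw [← incl_std]
  exact congrArg incl (lambdaFun_of_notMem f l _ fun i => by
    rw [height_map]
    exact hs i)

-- The plane at the left end of the last interval separates that factor from the concatenation of
-- the others, since each factor maps the part of the tube over its open interval into that same
-- part.
open Classical in
theorem isSeparated_lambda {j : ι} (hj : ∀ i, (l i).map (-1) ≤ (l j).map (-1)) :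
    IsSeparated (linkCurve (lambda (fun i : {i // i ≠ j} => l i) (pairwise_remove j hl)
        fun i => f i) x)
      (linkCurve ((l j).actLink (f j)) x) 1 ((l j).map (-1)) (iota x) := by
  have h1 := (l j).map_lt_map.mpr (show (-1 : ℝ) < 1 by norm_num)
  refine ⟨FramedStringLink.isLong_linkCurve _ x, FramedStringLink.isLong_linkCurve _ x,
    fun s hs => ?_, fun s hs => ?_, fun s hs => ?_, fun s hs => ?_⟩
  · exact linkCurve_lambda_of_notMem _ _ _ fun i h =>
      not_lt.mpr ((map_one_le_of_last hj i.2 hl).trans hs) h.2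
  · by_cases h : ∃ i : {i // i ≠ j}, s ∈ Ioo ((l i).map (-1)) ((l i).map 1)
    · obtain ⟨i, hi⟩ := h
      rw [linkCurve_lambda_of_mem _ _ _ i hi]
      exact (linkCurve_actLink_mem _ _ x hi).2.trans_le (map_one_le_of_last hj i.2 hl)
    · rw [linkCurve_lambda_of_notMem _ _ _ (not_exists.mp h)]
      exact hs
  · exact linkCurve_actLink_eq_line _ _ _ fun h => not_lt.mpr hs h.1
  · by_cases h : s ∈ Ioo ((l j).map (-1)) ((l j).map 1)
    · exact (linkCurve_actLink_mem _ _ x h).1.le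
    · rw [linkCurve_actLink_eq_line _ _ _ h]
      exact hs

open Classical in
theorem linkCurve_lambda_eq_superpose {j : ι} (hj : ∀ i, (l i).map (-1) ≤ (l j).map (-1)) :
    linkCurve (lambda l hl f) x =
      superpose (linkCurve (lambda (fun i : {i // i ≠ j} => l i) (pairwise_remove j hl)
        fun i => f i) x) (linkCurve ((l j).actLink (f j)) x) (iota x) 0 := by
  have hsep := isSeparated_lambda hl f x hj
  funext s
  by_cases hs : s ∈ Ioo ((l j).map (-1)) ((l j).map 1)
  · rw [hsep.superpose_of_le hs.1.le, linkCurve_lambda_of_mem hl f x j hs]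
    simp
  · rw [superpose_eq_left]
    · by_cases h : ∃ i : {i // i ≠ j}, s ∈ Ioo ((l i).map (-1)) ((l i).map 1)
      · obtain ⟨i, hi⟩ := h
        rw [linkCurve_lambda_of_mem hl f x i hi, linkCurve_lambda_of_mem _ _ x i hi]
      · rw [linkCurve_lambda_of_notMem _ _ x (not_exists.mp h), linkCurve_lambda_of_notMem]
        intro i hi
        by_cases hij : i = j
        · exact hs (hij ▸ hi)
        · exact h ⟨⟨i, hij⟩, hi⟩
    · rw [sub_zero]
      exact linkCurve_actLink_eq_line _ _ _ hs

end Lambda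

/-- Induction on the number of intervals, splitting off the last one; the index type is quantified
after `n` because removing an index changes it. Allowing arbitrary `x` and `y` covers the two
framings and the linking of the cores at once. -/
theorem linkingNumber_lambda_eq_zero
    {x y : Metric.closedBall (0 : ℂ) 1 ⊕ Metric.closedBall (0 : ℂ) 1} (hxy : x ≠ y)
    (hre : (iota x).re = (iota y).re) (n : ℕ) : ∀ {ι : Type} [Fintype ι] (_ : Fintype.card ι = n)
    {l : ι → LittleInterval} (hl : Pairwise fun i j => (l i).AlmostDisjoint (l j))
    (f : ι → FramedStringLink)
    (_ : ∀ i, linkingNumber (linkCurve (f i) x) (linkCurve (f i) y) = 0),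
    linkingNumber (linkCurve (lambda l hl f) x) (linkCurve (lambda l hl f) y) = 0 := by
  classical
  induction n with
  | zero =>
    intro ι _ hι l hl f _
    have := Fintype.card_eq_zero_iff.mp hι
    rw [funext fun s => linkCurve_lambda_of_notMem hl f x (s := s) isEmptyElim,
      funext fun s => linkCurve_lambda_of_notMem hl f y (s := s) isEmptyElim]
    exact linkingNumber_line _ _
  | succ n ih =>
    intro ι _ hι l hl f hf
    have : Nonempty ι := Fintype.card_pos_iff.mp (hι ▸ n.succ_pos)
    obtain ⟨j, hj⟩ := Finite.exists_max fun i => (l i).map (-1)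
    rw [linkCurve_lambda_eq_superpose hl f x hj, linkCurve_lambda_eq_superpose hl f y hj,
      (isSeparated_lambda hl f x hj).linkingNumber_superpose (isSeparated_lambda hl f y hj) hre
        (FramedStringLink.linkCurve_ne _ hxy) (FramedStringLink.linkCurve_ne _ hxy),
      (l j).linkingNumber_actLink (f j) hxy hre, hf j, add_zero]
    refine ih ?_ (pairwise_remove j hl) (fun i : {i // i ≠ j} => f i) fun i => hf i
    rw [Fintype.card_subtype_compl, Fintype.card_subtype_eq, hι, Nat.add_sub_cancel]

theorem iota_re (x : Metric.closedBall (0 : ℂ) 1 ⊕ Metric.closedBall (0 : ℂ) 1)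
    (hx : (Sum.elim Subtype.val Subtype.val x : ℂ).re = 0) : (iota x).re = 0 := by
  rcases x with z | z
  · simpa [iota, iotaUp] using hx
  · simpa [iota, iotaDown] using hx

theorem lambda_mem_fatStringLinksZero {ι : Type} [Fintype ι] {l : ι → LittleInterval}
    (hl : Pairwise fun i j => (l i).AlmostDisjoint (l j)) {f : ι → FramedStringLink}
    (hf : ∀ i, f i ∈ fatStringLinksZero) : lambda l hl f ∈ fatStringLinksZero := by
  have re_eq {x y} (hx hy) : (iota x).re = (iota y).re := (iota_re x hx).trans (iota_re y hy).symm
  refine ⟨?_, ?_, ?_⟩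
  · exact linkingNumber_lambda_eq_zero (x := .inl center) (y := .inl top)
      (fun h => center_ne_top (Sum.inl_injective h)) (re_eq center_re top_re) _ rfl hl f
      fun i => (hf i).1
  · exact linkingNumber_lambda_eq_zero (x := .inr center) (y := .inr top)
      (fun h => center_ne_top (Sum.inr_injective h)) (re_eq center_re top_re) _ rfl hl f
      fun i => (hf i).2.1
  · exact linkingNumber_lambda_eq_zero (x := .inl center) (y := .inr center) Sum.inl_ne_inr
      (re_eq center_re center_re) _ rfl hl f fun i => (hf i).2.2

/-! ## Composition of framed string links with framed long knots -/

/-- Each framing number of the composite is the sum of those of `k`, of the strand of `l` and of the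
inner knot. The linking number of the cores is the framing number of `k` plus the linking number of
the cores of `l`. -/
theorem compose_mem_fatStringLinksZero {k kUp kDown : FramedLongKnot} {l : FramedStringLink}
    (hk : k ∈ fatLongKnots) (hl : l ∈ fatStringLinksZero) (hUp : kUp ∈ fatLongKnots)
    (hDown : kDown ∈ fatLongKnots) : l.compose k kUp kDown ∈ fatStringLinksZero := by
  have hk0 : framingNumber k = 0 := hk
  have frame {E φ} (hE : IsTubeMap E φ) (h0 : framingNumber E = 0) {g : FramedLongKnot}
      (hg : g ∈ fatLongKnots) : framingNumber (k ∘ E ∘ g) = 0 := by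
    have h := (k.isTubeMap.comp hE).framingNumber_comp g
    rw [k.framingNumber_comp hE, hk0, h0, show framingNumber g = 0 from hg] at h
    rw [add_zero, add_zero] at h
    exact h
  refine ⟨frame l.isTubeMap_up hl.1 hUp, frame l.isTubeMap_down hl.2.1 hDown, ?_⟩
  have hne (p q : Tube) : (l ∘ Sum.inl) p ≠ (l ∘ Sum.inr) q :=
    fun h => Sum.inl_ne_inr (l.embedding.injective h)
  have ha : IsTubeCurve (fun s => kUp (s, center)) center :=
    kUp.isTubeMap.comp_curve (isTubeCurve_line center)
  have hb : IsTubeCurve (fun s => kDown (s, center)) center :=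
    kDown.isTubeMap.comp_curve (isTubeCurve_line center)
  have h1 := k.isTubeMap.linkingNumber_comp (l.isTubeMap_up.comp_curve ha)
    (l.isTubeMap_down.comp_curve hb) (by simp [iotaUp, iotaDown]) fun s t => hne _ _
  -- The inner knots lie in different strands, so both may be replaced by the core lines.
  have h2 := linkingNumber_straighten l.isTubeMap_up l.isTubeMap_down hne ha hb
    (by simp [iotaUp, iotaDown])
  -- The lower disc comes first because parallels are compared in order of increasing imaginary
  -- part; symmetry of the linking number restores the other order.
  have h3 : linkingNumber (curve k (iotaDown center)) (curve k (iotaUp center)) = framingNumber k :=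
    k.linkingNumber_curve_eq (by simp [iotaUp, iotaDown]) (center_re.trans top_re.symm)
      (by simp [iotaUp, iotaDown, center_im]) (by simp [center_im, top_im])
  rw [h2] at h1
  refine h1.trans ?_
  rw [linkingNumber_swap, h3, hk0, hl.2.2, add_zero]

/-! ### Closure under the operad action -/

theorem entriesOf_mem {n : ℕ} {t : Fin n → Color} {f : ∀ i, X (t i)} {A : (s : Color) → Set (X s)}
    (hf : ∀ i, f i ∈ A (t i)) (s : Color) (i : {i // t i = s}) : entriesOf f s i ∈ A s := by
  -- Eliminating the equation of colours turns the transport in `entriesOf` into the identity.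
  obtain ⟨i, rfl⟩ := i
  exact hf i

end StringLinks

open StringLinks in
theorem mainTheorem2 : StringLinks.IsSubSCLAlgebra StringLinks.fatQuadruplet := by
  intro n t s L hL f hf
  have knot := fun s i => entriesOf_mem hf s i
  cases s with
  | o =>
    exact compose_mem_fatStringLinksZero (kappaList_mem_fatLongKnots _ (knot .both) _)
      (lambda_mem_fatStringLinksZero _ (knot .o)) (kappaList_mem_fatLongKnots _ (knot .up) _)
      (kappaList_mem_fatLongKnots _ (knot .down) _)
  | up => exact kappaList_mem_fatLongKnots _ (knot .up) _
  | down => exact kappaList_mem_fatLongKnots _ (knot .down) _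
  | both => exact kappaList_mem_fatLongKnots _ (knot .both) _
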